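/- **Setting.** Let $\mathcal P\subset\mathbb R^{d_{\mathcal P}}$ ($d_{\mathcal P}\ge 1$) and $\mathcal L\subset\mathbb R^{d_{\mathcal L}}$ be compact and convex with $B_{d_{\mathcal P}}(1)\subseteq\mathcal P\subseteq B_{d_{\mathcal P}}(d_{\mathcal P})$, where $B_n(r)$ is the closed Euclidean ball of radius $r$ in $\mathbb R^n$ centered at $0$. Let $u:\mathcal P\times\mathcal L\to\mathbb R^d$ be bi-affine with $\|u(p,\ell)\|\le 1$, and let $p^*:\mathcal L\to\mathcal P$ be an arbitrary response function. For $Q\subseteq\mathcal L$ put $S(Q)=\mathrm{conv}\{u(p^*(\ell),\ell):\ell\in Q\}$. In round $t=1,\dots,T$ the learner plays $p_t\in\mathcal P$, depending only on $\ell_1,\dots,\ell_{t-1}$, and then observes the adversary's action $\ell_t\in\mathcal L$. A learner, which may be tuned to the horizon $T$, is *strictly opportunistic with rate $\gamma(T)$* if, for every sequence $\ell_1,\dots,\ell_T\in\mathcal L$, $$\mathrm{dist}\Big(\tfrac1T\sum_{t=1}^T u(p_t,\ell_t),\,S(Q)\Big)\le\gamma(T),\qquad Q=\mathrm{conv}\{\ell_1,\dots,\ell_T\}.$$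 **Algorithm.** Let $L=\lceil (T/d_{\mathcal P})^{2/3}\rceil$ and $T_e=\lceil T/L\rceil$. Divide the $T$ rounds into consecutive epochs of $T_e$ rounds (the last one may be incomplete). Let $\mathcal N\subseteq\mathcal P$ be a finite set with $|\mathcal N|\le(3d_{\mathcal P}T)^{d_{\mathcal P}}$ such that every point of $\mathcal P$ is within distance $1/T$ of $\mathcal N$. * *Outer learner* (online gradient descent on the unit ball, maximizing $\langle\cdot,g_e\rangle$): $\lambda_1\in B_d(1)$ is arbitrary, and after the full epoch $e=1,2,\dots$ one sets $\lambda_{e+1}=\Pi_{B_d(1)}\big(\lambda_e+g_e/\sqrt e\big)$, where $$g_e=\frac1{T_e}\sum_{t\in\text{epoch }e}\big(u(p_t,\ell_t)-u_e^*\big),\quad u_e^*=u(p^*(\ell_e^*),\ell_e^*),\quad \ell^*_e\in\operatorname*{argmax}_{\ell\in Q_e}\min_{p\in\mathcal P}\langle\lambda_e,u(p,\ell)\rangle,$$ $Q_e$ is the convex hull of the adversary's actions in epoch $e$, and ties are broken by any fixed rule depending on the epoch's actions and $\lambda_e$. * *Inner learner* (MsMwC over $\mathcal N$, restarted in every epoch):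 number the rounds of the epoch $t=1,2,\dots$ and let $y_t(q)=f_t(q)$, $q\in\mathcal N$, where $$f_t(p)=\max_{t'\le t}\langle\lambda_e,u(p,\ell_{t'})\rangle,$$ with $t'$ ranging over the rounds of the current epoch up to $t$. Let $\Omega$ be the set of probability vectors on $\mathcal N$ with all entries at least $1/(|\mathcal N|T_e)$; let $m_1=0$, $m_t=y_{t-1}$ for $t\ge2$; let $w_1'$ be uniform; let $$\eta_{t,q}=\min\Big\{\tfrac1{64},\ \Big(\log(|\mathcal N|T_e)\Big/\sum_{s<t}(y_s(q)-m_s(q))^2\Big)^{1/2}\Big\}$$ (equal to $1/64$ when the sum is $0$); let $a_t(q)=32\,\eta_{t,q}(y_t(q)-m_t(q))^2$; and let $D_t(w,v)=\sum_q\eta_{t,q}^{-1}\big(w_q\log(w_q/v_q)-w_q+v_q\big)$. Then $$w_t=\operatorname*{argmin}_{w\in\Omega}\ \langle w,m_t\rangle+D_t(w,w_t'),\qquad w'_{t+1}=\operatorname*{argmin}_{w\in\Omega}\ \langle w,y_t+a_t\rangle+D_t(w,w_t'),$$ and the learner plays the barycentre $p_t=\sum_{q\in\mathcal N}w_t(q)\,q$.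 **Theorem.** There is a universal constant $C>0$ such that for all such $\mathcal P,\mathcal L,u,p^*$ (in all dimensions $d_{\mathcal P}\ge1$, $d_{\mathcal L}$, $d$) and all $T\ge1$: a cover $\mathcal N$ as above exists, and for every such cover, every $\lambda_1\in B_d(1)$ and every tie-breaking rule, the algorithm plays actions in $\mathcal P$ and is strictly opportunistic with $$\gamma(T)=C\,d_{\mathcal P}^{1/3}\,T^{-1/3}\,(1+\log T)=\tilde O\big(d_{\mathcal P}^{1/3}T^{-1/3}\big).$$ -/

import Mathlib

open scoped RealInnerProductSpace

noncomputable section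

/-- `ℝⁿ` with the Euclidean norm. -/
abbrev Euc (n : ℕ) : Type := EuclideanSpace ℝ (Fin n)

namespace OppApproach

/-! ### Approachability instances -/

/-- `u : P × L → ℝᵈ` is affine in each argument (only its values on `P × L` matter). -/
structure IsBiaffineOn {m n d : ℕ} (P : Set (Euc m)) (L : Set (Euc n))
    (u : Euc m → Euc n → Euc d) : Prop where
  left : ∀ l ∈ L, ∀ p ∈ P, ∀ q ∈ P, ∀ a b : ℝ, 0 ≤ a → 0 ≤ b → a + b = 1 →
    u (a • p + b • q) l = a • u p l + b • u q l
  right : ∀ p ∈ P, ∀ l ∈ L, ∀ k ∈ L, ∀ a b : ℝ, 0 ≤ a → 0 ≤ b → a + b = 1 →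
    u p (a • l + b • k) = a • u p l + b • u p k

/-- The standing assumptions on a response-based approachability instance with learner set `P`,
adversary set `L`, payoff `u` and response function `pstar`. -/
structure IsInstance {m n d : ℕ} (P : Set (Euc m)) (L : Set (Euc n))
    (u : Euc m → Euc n → Euc d) (pstar : Euc n → Euc m) : Prop where
  compact_P : IsCompact P
  convex_P : Convex ℝ P
  compact_L : IsCompact L
  convex_L : Convex ℝ L
  ball_subset : Metric.closedBall (0 : Euc m) 1 ⊆ P
  subset_ball : P ⊆ Metric.closedBall (0 : Euc m) m
  biaffine : IsBiaffineOn P L u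
  norm_le_one : ∀ p ∈ P, ∀ l ∈ L, ‖u p l‖ ≤ 1
  response_mem : ∀ l ∈ L, pstar l ∈ P

/-- The target set `S(Q) = conv {u(p*(ℓ), ℓ) | ℓ ∈ Q}`. -/
def targetSet {m n d : ℕ} (u : Euc m → Euc n → Euc d) (pstar : Euc n → Euc m)
    (Q : Set (Euc n)) : Set (Euc d) :=
  convexHull ℝ ((fun l => u (pstar l) l) '' Q)

/-! ### Online algorithms -/

/-- A deterministic online algorithm: in every round it plays `act` of its current state, then
receives a feedback `b : B` and updates its state. So each action depends on past feedback only.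
An online optimization oracle over `A` is an `OnlineAlgorithm A (A → ℝ)`, an expert oracle over
`ι` is an `OnlineAlgorithm (ι → ℝ) (ι → ℝ)`, and a learner in the approachability game is an
`OnlineAlgorithm` whose feedback is the adversary's action. -/
structure OnlineAlgorithm (A B : Type) where
  State : Type
  start : State
  act : State → A
  update : State → B → State

/-- The state at the beginning of round `t` (rounds are numbered from `0`). -/
def OnlineAlgorithm.stateAt {A B : Type} (alg : OnlineAlgorithm A B) (b : ℕ → B) :
    ℕ → alg.State
  | 0 => alg.start
  | t + 1 => alg.update (alg.stateAt b t) (b t)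

/-- The action played in round `t` against the feedback sequence `b`. -/
def OnlineAlgorithm.play {A B : Type} (alg : OnlineAlgorithm A B) (b : ℕ → B) (t : ℕ) : A :=
  alg.act (alg.stateAt b t)

/-- The average payoff vector over the first `T` rounds. -/
def avgPayoff {m n d : ℕ} (u : Euc m → Euc n → Euc d) (alg : OnlineAlgorithm (Euc m) (Euc n))
    (T : ℕ) (l : ℕ → Euc n) : Euc d :=
  (1 / (T : ℝ)) • ∑ t ∈ Finset.range T, u (alg.play l t) (l t)

/-- Over the horizon `T`, the learner `alg` (which may be tuned to `T`) is strictly opportunistic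
with error `γ`: against every sequence of adversary actions in `L` it plays actions in `P`, and its
average payoff has distance at most `γ` to `S(Q)` for `Q` the convex hull of the played actions. -/
def IsStrictlyOpportunistic {m n d : ℕ} (P : Set (Euc m)) (L : Set (Euc n))
    (u : Euc m → Euc n → Euc d) (pstar : Euc n → Euc m) (T : ℕ)
    (alg : OnlineAlgorithm (Euc m) (Euc n)) (γ : ℝ) : Prop :=
  ∀ l : ℕ → Euc n, (∀ t < T, l t ∈ L) →
    (∀ t < T, alg.play l t ∈ P) ∧
    Metric.infDist (avgPayoff u alg T l)
      (targetSet u pstar (convexHull ℝ (l '' {t | t < T}))) ≤ γ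

/-! ### The epoch-based framework -/

/-- State of the epoch-based learner; `hist` lists the pairs (learner action, adversary action) of
the current epoch, most recent first. -/
structure EpochState (E F SOut SIn : Type) where
  outer : SOut
  inner : SIn
  hist : List (E × F)

/-- The epoch-based opportunistic learner with epochs of `Te` rounds.
* `outer` is an online (convex) optimization oracle over directions, `inner` one over actions.
* `F` is the loss rule and `U` the target function; both see the adversary actions of the current
  epoch (most recent first) and the direction of the epoch.
* After a full epoch the outer oracle receives the vector
  `g = (1/Te) ∑ (u(p_t, ℓ_t) - u*)`. The direction is to make the gain `⟪·, g⟫` large, so the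
  loss fed to the (loss-minimizing) oracle is `-⟪·, g⟫`. Then a fresh inner oracle is started. -/
def epochLearner {m n d : ℕ} (u : Euc m → Euc n → Euc d)
    (outer : OnlineAlgorithm (Euc d) (Euc d → ℝ)) (inner : OnlineAlgorithm (Euc m) (Euc m → ℝ))
    (F : List (Euc n) → Euc d → Euc m → ℝ) (U : List (Euc n) → Euc d → Euc d) (Te : ℕ) :
    OnlineAlgorithm (Euc m) (Euc n) where
  State := EpochState (Euc m) (Euc n) outer.State inner.State
  start := ⟨outer.start, inner.start, []⟩
  act s := inner.act s.inner
  update s l :=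
    let lam : Euc d := outer.act s.outer
    let hist : List (Euc m × Euc n) := (inner.act s.inner, l) :: s.hist
    if hist.length = Te then
      let target : Euc d := U (hist.map Prod.snd) lam
      let g : Euc d := (1 / (Te : ℝ)) • (hist.map fun x => u x.1 x.2 - target).sum
      ⟨outer.update s.outer (fun x => -⟪x, g⟫), inner.start, []⟩
    else
      ⟨s.outer, inner.update s.inner (F (hist.map Prod.snd) lam), hist⟩

/-! ### The loss rule and the target function -/

/-- Running-max loss `p ↦ max_{t' ≤ t} ⟪lam, u(p, ℓ_{t'})⟫`, `t'` ranging over the rounds of the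
epoch so far. -/
def runningMaxLoss {m n d : ℕ} (u : Euc m → Euc n → Euc d) (ls : List (Euc n)) (lam : Euc d)
    (p : Euc m) : ℝ :=
  sSup ((fun l => ⟪lam, u p l⟫) '' {l | l ∈ ls})

/-- `l` maximizes `ℓ ↦ min_{p ∈ P} ⟪lam, u(p, ℓ)⟫` over the convex hull of the points in `ls`. -/
def IsMaximinPoint {m n d : ℕ} (P : Set (Euc m)) (u : Euc m → Euc n → Euc d)
    (ls : List (Euc n)) (lam : Euc d) (l : Euc n) : Prop :=
  l ∈ convexHull ℝ {k | k ∈ ls} ∧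
    IsMaxOn (fun k => sInf ((fun p => ⟪lam, u p k⟫) '' P)) (convexHull ℝ {k | k ∈ ls}) l

/-- `sel` is a tie-breaking rule for the choice of a maximin point. -/
def IsMaximinSelector {m n d : ℕ} (P : Set (Euc m)) (u : Euc m → Euc n → Euc d)
    (sel : List (Euc n) → Euc d → Euc n) : Prop :=
  ∀ ls lam, (∃ l, IsMaximinPoint P u ls lam l) → IsMaximinPoint P u ls lam (sel ls lam)

/-- Target function `u* = u(p*(ℓ*), ℓ*)` with `ℓ*` the selected maximin point. -/
def maximinTarget {m n d : ℕ} (u : Euc m → Euc n → Euc d) (pstar : Euc n → Euc m)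
    (sel : List (Euc n) → Euc d → Euc n) (ls : List (Euc n)) (lam : Euc d) : Euc d :=
  u (pstar (sel ls lam)) (sel ls lam)

/-! ### Outer oracle: online gradient descent on the unit ball -/

/-- Euclidean projection onto the closed unit ball. -/
def projUnitBall {d : ℕ} (y : Euc d) : Euc d := (max 1 ‖y‖)⁻¹ • y

/-- Online gradient descent on the closed unit ball, started at `x₁`, with step size
`D / (G √e) = 1 / √e` in its round `e = 1, 2, …` (diameter `D = 2`, gradients bounded by `G = 2`).
The state is the pair (round, iterate). -/
def ogd {d : ℕ} (x₁ : Euc d) : OnlineAlgorithm (Euc d) (Euc d → ℝ) where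
  State := ℕ × Euc d
  start := (1, x₁)
  act s := s.2
  update s f := (s.1 + 1, projUnitBall (s.2 - (1 / √(s.1 : ℝ)) • gradient f s.2))

/-! ### Inner oracle: MsMwC over a finite cover -/

/-- A minimizer of `f` over `S` (if there is one). -/
def argminOn {X : Type} [Nonempty X] (f : X → ℝ) (S : Set X) : X :=
  Classical.epsilon fun w => w ∈ S ∧ IsMinOn f S w

/-- The probability vectors on `ι` whose entries are all at least `1 / (|ι| n)`. -/
def truncatedSimplex (ι : Type) [Fintype ι] (n : ℕ) : Set (ι → ℝ) :=
  {w | (∀ i, 1 / ((Fintype.card ι : ℝ) * n) ≤ w i) ∧ ∑ i, w i = 1}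

/-- The Bregman divergence of the weighted negative entropy `w ↦ ∑ i, w i * log (w i) / η i`. -/
def weightedKL {ι : Type} [Fintype ι] (η w v : ι → ℝ) : ℝ :=
  ∑ i, (η i)⁻¹ * (w i * Real.log (w i / v i) - w i + v i)

/-- The mirror step `argmin_w ⟨w, c⟩ + D_η(w, v)` over the truncated simplex. -/
def mirrorStep {ι : Type} [Fintype ι] (n : ℕ) (η c v : ι → ℝ) : ι → ℝ :=
  argminOn (fun w : ι → ℝ => ∑ i, w i * c i + weightedKL η w v) (truncatedSimplex ι n)

/-- State of MsMwC at the beginning of its round `t`: the auxiliary iterate `w'_t`, the prediction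
`m_t`, and the sums `∑_{s<t} (y_{s,i} - m_{s,i})²`. -/
structure MsMwCState (ι : Type) where
  aux : ι → ℝ
  pred : ι → ℝ
  dev : ι → ℝ

/-- Learning rates `η_{t,i} = min {1/64, √(log (|ι| n) / ∑_{s<t} (y_{s,i} - m_{s,i})²)}`,
equal to `1/64` while the sum is `0`. -/
def msRate {ι : Type} [Fintype ι] (n : ℕ) (s : MsMwCState ι) (i : ι) : ℝ :=
  (max 64 √(s.dev i / Real.log ((Fintype.card ι : ℝ) * n)))⁻¹

/-- Multi-scale multiplicative weights with correction on the experts `ι`, for the horizon `n`,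
with optimistic predictions `m_1 = 0`, `m_t = y_{t-1}`, corrections `a = 32 η (y - m)²`, and uniform
start. -/
def msMwC (ι : Type) [Fintype ι] (n : ℕ) : OnlineAlgorithm (ι → ℝ) (ι → ℝ) where
  State := MsMwCState ι
  start := ⟨fun _ => 1 / (Fintype.card ι : ℝ), fun _ => 0, fun _ => 0⟩
  act s := mirrorStep n (msRate n s) s.pred s.aux
  update s y :=
    ⟨mirrorStep n (msRate n s) (fun i => y i + 32 * msRate n s i * (y i - s.pred i) ^ 2) s.aux,
      y,
      fun i => s.dev i + (y i - s.pred i) ^ 2⟩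

/-- An expert oracle over the finite set `N` as an oracle over actions: it plays the barycentre of
its mixed action, and a loss function is evaluated at the points of `N`. -/
def expertOracle {m : ℕ} (N : Finset (Euc m)) (alg : OnlineAlgorithm (N → ℝ) (N → ℝ)) :
    OnlineAlgorithm (Euc m) (Euc m → ℝ) where
  State := alg.State
  start := alg.start
  act s := ∑ i : N, alg.act s i • (i : Euc m)
  update s f := alg.update s (fun i => f i)

/-- `N` is a finite `1/T`-cover of `P` by points of `P`, of size at most `(3 m T)^m`. -/
structure IsFineCover {m : ℕ} (P : Set (Euc m)) (T : ℕ) (N : Finset (Euc m)) : Prop where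
  subset : (N : Set (Euc m)) ⊆ P
  cover : ∀ p ∈ P, ∃ q ∈ N, dist p q ≤ 1 / (T : ℝ)
  card_le : N.card ≤ (3 * m * T) ^ m

/-! ### The tuned algorithm -/

/-- The number of epochs `⌈(T/m)^{2/3}⌉`. -/
def numEpochs (m T : ℕ) : ℕ := ⌈((T : ℝ) / m) ^ (2 / 3 : ℝ)⌉₊

/-- The epoch length `⌈T / L⌉` for `L` epochs (the last epoch is cut off at the horizon). -/
def epochLength (m T : ℕ) : ℕ := ⌈(T : ℝ) / numEpochs m T⌉₊

/-- The epoch-based learner with the running-max loss, the maximin target, online gradient descent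
as outer oracle, and MsMwC over the cover `N` as inner oracle, tuned to the horizon `T`. -/
def fastLearner {m n d : ℕ} (u : Euc m → Euc n → Euc d) (pstar : Euc n → Euc m)
    (T : ℕ) (N : Finset (Euc m)) (lam₁ : Euc d) (sel : List (Euc n) → Euc d → Euc n) :
    OnlineAlgorithm (Euc m) (Euc n) :=
  epochLearner u (ogd lam₁) (expertOracle N (msMwC N (epochLength m T)))
    (runningMaxLoss u) (maximinTarget u pstar sel) (epochLength m T)

end OppApproach

end

namespace OppApproach

/-! ### Covers of bounded sets -/

/-! Write τ for the epoch length and E = ⌊T/τ⌋ for the number of complete epochs. Each epoch target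
u*_e is a response payoff at a point of Q_e ⊆ Q, so it lies in S(Q), and by convexity so does the
average of the targets. The distance to S(Q) is therefore at most (τ/T)‖∑ g_e‖, plus at most 2τ/T
for the rounds left over at the end. By duality ‖∑ g_e‖ is a supremum of ⟪z, ∑ g_e⟫ over unit
vectors z, hence at most the regret 6√E of gradient descent (`ogd_regret`) plus ∑ ⟪λ_e, g_e⟫.

Inside an epoch, Sion's theorem provides one action a ∈ P with ⟪λ_e, u(a, ℓ)⟫ ≤ ⟪λ_e, u*_e⟫ for
every ℓ played in that epoch (`exists_le_maximinTarget`). The running-max loss dominates the true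
loss of each round, is convex in the action, and at a never exceeds ⟪λ_e, u*_e⟫. So τ⟪λ_e, g_e⟫ is
at most the regret of the inner learner against a point of the cover near a, plus a bounded
discretization error (`epoch_regret`).

The gain in speed comes from monotonicity. Running-max losses increase in time and stay in [-1, 1],
so their squared increments sum to at most 5 (`msMwC_dev_le`). The learning rates of MsMwC then
never leave 1/64, its divergences telescope, and its regret is O(log |N|) = O(m log T) for m ≤ T,
with m = d_P, whatever the epoch length (`msMwC_regret`).

The total error (6τ√E + E·O(m log T) + 2τ)/T is balanced by τ ≈ m^(2/3) T^(1/3) and E ≈ (T/m)^(2/3)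
(`tuned_bound`). For m > T the claimed rate exceeds the trivial bound 2. -/

lemma card_le_of_separated {E : Type*} [NormedAddCommGroup E] [NormedSpace ℝ E]
    [FiniteDimensional ℝ E] {R δ : ℝ} (hR : 0 ≤ R) (hδ : 0 < δ) (s : Finset E)
    (hs : ∀ c ∈ s, ‖c‖ ≤ R) (h : ∀ c ∈ s, ∀ d ∈ s, c ≠ d → δ ≤ dist c d) :
    (s.card : ℝ) ≤ (2 * R / δ + 1) ^ Module.finrank ℝ E := by
  borelize E
  let μ : MeasureTheory.Measure E := MeasureTheory.Measure.addHaar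
  have hρ : 0 < R + δ / 2 := by positivity
  have hδ2 : 0 < δ / 2 := by positivity
  have disj : (s : Set E).Pairwise
      (Function.onFun Disjoint fun c => Metric.ball (c : E) (δ / 2)) := by
    rintro c hc d hd hcd
    apply Metric.ball_disjoint_ball
    linarith [h c hc d hd hcd]
  have sub : (⋃ c ∈ s, Metric.ball (c : E) (δ / 2)) ⊆ Metric.ball (0 : E) (R + δ / 2) := by
    refine Set.iUnion₂_subset fun x hx => Metric.ball_subset_ball' ?_
    rw [dist_zero_right]
    linarith [hs x hx]
  -- Packing by volume: the balls of radius δ/2 around the points are disjoint and lie in the ball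
  -- of radius R + δ/2.
  have I : (s.card : ENNReal) * ENNReal.ofReal ((δ / 2) ^ Module.finrank ℝ E) *
        μ (Metric.ball 0 1) ≤
      ENNReal.ofReal ((R + δ / 2) ^ Module.finrank ℝ E) * μ (Metric.ball 0 1) :=
    calc
      _ = μ (⋃ c ∈ s, Metric.ball (c : E) (δ / 2)) := by
        rw [MeasureTheory.measure_biUnion_finset disj fun c _ => measurableSet_ball]
        simp only [μ.addHaar_ball_of_pos _ hδ2]
        simp only [Finset.sum_const, nsmul_eq_mul, mul_assoc]
      _ ≤ μ (Metric.ball (0 : E) (R + δ / 2)) := MeasureTheory.measure_mono sub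
      _ = _ := by simp only [μ.addHaar_ball_of_pos _ hρ]
  have J := (ENNReal.mul_le_mul_iff_left (Metric.measure_ball_pos _ _ zero_lt_one).ne'
    MeasureTheory.measure_ball_lt_top.ne).1 I
  have K := ENNReal.toReal_le_of_le_ofReal (pow_nonneg hρ.le _) J
  rw [ENNReal.toReal_mul, ENNReal.toReal_natCast, ENNReal.toReal_ofReal (by positivity)] at K
  have e : 2 * R / δ + 1 = (R + δ / 2) / (δ / 2) := by field_simp
  rw [e, div_pow, le_div_iff₀ (by positivity)]
  exact K

/-- A δ-separated subset of largest cardinality is a cover, since an uncovered point could be added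
to it. The packing bound ensures that a largest cardinality exists and also bounds it. -/
lemma exists_finset_cover {E : Type*} [NormedAddCommGroup E] [NormedSpace ℝ E]
    [FiniteDimensional ℝ E] {R δ : ℝ} (hR : 0 ≤ R) (hδ : 0 < δ) {P : Set E}
    (hP : P ⊆ Metric.closedBall 0 R) :
    ∃ N : Finset E, (N : Set E) ⊆ P ∧ (∀ p ∈ P, ∃ q ∈ N, dist p q ≤ δ) ∧
      (N.card : ℝ) ≤ (2 * R / δ + 1) ^ Module.finrank ℝ E := by
  classical
  let good : Finset E → Prop := fun N =>
    (N : Set E) ⊆ P ∧ ∀ c ∈ N, ∀ d ∈ N, c ≠ d → δ < dist c d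
  have bound : ∀ N, good N → (N.card : ℝ) ≤ (2 * R / δ + 1) ^ Module.finrank ℝ E := by
    rintro N ⟨hN, hsep⟩
    exact card_le_of_separated hR hδ N (fun c hc => by simpa using hP (hN hc))
      fun c hc d hd hcd => (hsep c hc d hd hcd).le
  let cards : Set ℕ := Finset.card '' {N | good N}
  have hne : cards.Nonempty := ⟨0, ∅, by simp [good], rfl⟩
  have hbdd : BddAbove cards := by
    refine ⟨⌊(2 * R / δ + 1) ^ Module.finrank ℝ E⌋₊, ?_⟩
    rintro _ ⟨N, hN, rfl⟩
    exact Nat.le_floor (bound N hN)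
  obtain ⟨N, hN, hcard⟩ := Nat.sSup_mem hne hbdd
  refine ⟨N, hN.1, fun p hp => ?_, bound N hN⟩
  by_contra! hfar
  have hpN : p ∉ N := fun h => by simpa using (hδ.trans (hfar p h))
  have hins : good (insert p N) := by
    refine ⟨by simpa [Set.insert_subset_iff, hp] using hN.1, fun c hc d hd hcd => ?_⟩
    rcases Finset.mem_insert.1 hc with rfl | hc' <;> rcases Finset.mem_insert.1 hd with rfl | hd'
    · exact absurd rfl hcd
    · exact hfar d hd'
    · rw [dist_comm]; exact hfar c hc'
    · exact hN.2 c hc' d hd' hcd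
  have := le_csSup hbdd ⟨_, hins, rfl⟩
  rw [Finset.card_insert_of_notMem hpN, hcard] at this
  omega

lemma exists_isFineCover {m T : ℕ} (hm : 0 < m) (hT : 1 ≤ T) {P : Set (Euc m)}
    (hP : P ⊆ Metric.closedBall (0 : Euc m) m) : ∃ N : Finset (Euc m), IsFineCover P T N := by
  have hT' : (1 : ℝ) ≤ T := by exact_mod_cast hT
  have hm' : (1 : ℝ) ≤ m := by exact_mod_cast hm
  obtain ⟨N, h1, h2, h3⟩ := exists_finset_cover (δ := 1 / (T : ℝ)) (Nat.cast_nonneg m)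
    (by positivity) hP
  refine ⟨N, h1, h2, ?_⟩
  rw [finrank_euclideanSpace_fin] at h3
  have : (N.card : ℝ) ≤ (3 * m * T : ℝ) ^ m := by
    -- For R = m and δ = 1/T the base is 2mT + 1, and 1 ≤ mT.
    refine h3.trans (pow_le_pow_left₀ (by positivity) ?_ _)
    rw [div_div_eq_mul_div, div_one]
    nlinarith
  exact_mod_cast this

/-! ### Bi-affine payoffs -/

section Biaffine

variable {m n d : ℕ} {P : Set (Euc m)} {L : Set (Euc n)} {u : Euc m → Euc n → Euc d}
  {pstar : Euc n → Euc m}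

lemma IsInstance.zero_mem (h : IsInstance P L u pstar) : (0 : Euc m) ∈ P :=
  h.ball_subset (by simp)

lemma IsInstance.convexOn_left (h : IsInstance P L u pstar) (lam : Euc d) {l : Euc n}
    (hl : l ∈ L) : ConvexOn ℝ P fun p => ⟪lam, u p l⟫ := by
  refine ⟨h.convex_P, fun p hp q hq a b ha hb hab => le_of_eq ?_⟩
  simp only [h.biaffine.left l hl p hp q hq a b ha hb hab, inner_add_right, inner_smul_right,
    smul_eq_mul]

lemma IsInstance.convexOn_right (h : IsInstance P L u pstar) (lam : Euc d) {p : Euc m}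
    (hp : p ∈ P) : ConvexOn ℝ L fun l => ⟪lam, u p l⟫ := by
  refine ⟨h.convex_L, fun l hl k hk a b ha hb hab => le_of_eq ?_⟩
  simp only [h.biaffine.right p hp l hl k hk a b ha hb hab, inner_add_right, inner_smul_right,
    smul_eq_mul]

lemma IsInstance.concaveOn_right (h : IsInstance P L u pstar) (lam : Euc d) {p : Euc m}
    (hp : p ∈ P) : ConcaveOn ℝ L fun l => ⟪lam, u p l⟫ := by
  refine ⟨h.convex_L, fun l hl k hk a b ha hb hab => ge_of_eq ?_⟩
  simp only [h.biaffine.right p hp l hl k hk a b ha hb hab, inner_add_right, inner_smul_right,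
    smul_eq_mul]

lemma IsInstance.abs_inner_le (h : IsInstance P L u pstar) {lam : Euc d} (hlam : ‖lam‖ ≤ 1)
    {p : Euc m} (hp : p ∈ P) {l : Euc n} (hl : l ∈ L) : |⟪lam, u p l⟫| ≤ 1 :=
  (abs_real_inner_le_norm _ _).trans
    (mul_le_one₀ hlam (norm_nonneg _) (h.norm_le_one p hp l hl))

/-- This is where the unit ball inside P enters. With r = dist p q and v = (q - p)/r ∈ P, the points
p + r v and q + r 0, both divided by 1 + r, coincide. Affinity on P then gives u(p) - u(q) = r (u(0)
- u(v)), with no affine extension beyond P. -/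
lemma IsInstance.norm_sub_le (h : IsInstance P L u pstar) {l : Euc n} (hl : l ∈ L)
    {p q : Euc m} (hp : p ∈ P) (hq : q ∈ P) : ‖u p l - u q l‖ ≤ 2 * dist p q := by
  rcases eq_or_ne p q with rfl | hpq
  · simp
  have hr : 0 < dist p q := dist_pos.2 hpq
  set r := dist p q with hrdef
  set v : Euc m := r⁻¹ • (q - p) with hv
  have hvP : v ∈ P := by
    apply h.ball_subset
    rw [mem_closedBall_zero_iff, hv, norm_smul, ← dist_eq_norm, dist_comm, ← hrdef, norm_inv,
      Real.norm_of_nonneg hr.le, inv_mul_cancel₀ hr.ne']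
  have h1 : (0 : ℝ) ≤ (1 + r)⁻¹ := by positivity
  have h2 : (0 : ℝ) ≤ r * (1 + r)⁻¹ := by positivity
  have h3 : (1 + r)⁻¹ + r * (1 + r)⁻¹ = 1 := by field_simp
  have e1 := h.biaffine.left l hl p hp v hvP _ _ h1 h2 h3
  have e2 := h.biaffine.left l hl q hq 0 h.zero_mem _ _ h1 h2 h3
  have e3 : (1 + r)⁻¹ • p + (r * (1 + r)⁻¹) • v = (1 + r)⁻¹ • q + (r * (1 + r)⁻¹) • (0 : Euc m) := by
    rw [hv, smul_smul, show r * (1 + r)⁻¹ * r⁻¹ = (1 + r)⁻¹ by field_simp]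
    simp [smul_sub]
  rw [e3, e2] at e1
  have e4 : u p l - u q l = r • (u 0 l - u v l) := by
    have := congrArg (fun x => (1 + r) • x) e1
    simp only [smul_add, smul_smul] at this
    rw [show (1 + r) * (1 + r)⁻¹ = 1 by field_simp,
      show (1 + r) * (r * (1 + r)⁻¹) = r by field_simp, one_smul, one_smul] at this
    rw [smul_sub, sub_eq_sub_iff_add_eq_add, add_comm (r • u 0 l), ← this.symm]
  rw [e4, norm_smul, Real.norm_of_nonneg hr.le, mul_comm]
  gcongr
  have := _root_.norm_sub_le (u 0 l) (u v l)
  linarith [h.norm_le_one 0 h.zero_mem l hl, h.norm_le_one v hvP l hl]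

lemma IsInstance.inner_sub_le (h : IsInstance P L u pstar) {lam : Euc d} (hlam : ‖lam‖ ≤ 1)
    {l : Euc n} (hl : l ∈ L) {p q : Euc m} (hp : p ∈ P) (hq : q ∈ P) :
    |⟪lam, u p l⟫ - ⟪lam, u q l⟫| ≤ 2 * dist p q := by
  rw [← inner_sub_right]
  exact (abs_real_inner_le_norm _ _).trans
    ((mul_le_of_le_one_left (norm_nonneg _) hlam).trans (h.norm_sub_le hl hp hq))

lemma IsInstance.continuousOn_inner (h : IsInstance P L u pstar) {lam : Euc d} (hlam : ‖lam‖ ≤ 1)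
    {l : Euc n} (hl : l ∈ L) : ContinuousOn (fun p => ⟪lam, u p l⟫) P := by
  refine LipschitzOnWith.continuousOn (K := 2) (LipschitzOnWith.of_dist_le_mul fun p hp q hq => ?_)
  rw [Real.dist_eq]
  exact h.inner_sub_le hlam hl hp hq

lemma IsInstance.bddBelow (h : IsInstance P L u pstar) {lam : Euc d} (hlam : ‖lam‖ ≤ 1)
    {l : Euc n} (hl : l ∈ L) : BddBelow ((fun p => ⟪lam, u p l⟫) '' P) := by
  refine ⟨-1, ?_⟩
  rintro _ ⟨p, hp, rfl⟩
  exact (abs_le.1 (h.abs_inner_le hlam hp hl)).1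

/-- Minimax: there is an action that holds every played point below the value of the target. -/
theorem IsInstance.exists_le_maximinTarget (h : IsInstance P L u pstar) {lam : Euc d}
    (hlam : ‖lam‖ ≤ 1) {ls : List (Euc n)} (hne : ls ≠ []) (hls : ∀ l ∈ ls, l ∈ L)
    {sel : List (Euc n) → Euc d → Euc n} (hsel : IsMaximinSelector P u sel) :
    sel ls lam ∈ convexHull ℝ {k | k ∈ ls} ∧
    ∃ a ∈ P, ∀ l ∈ ls, ⟪lam, u a l⟫ ≤ ⟪lam, maximinTarget u pstar sel ls lam⟫ := by
  have hlen : 0 < ls.length := List.length_pos_iff.2 hne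
  let pt : Fin ls.length → Euc n := fun i => ls[i]
  have hpt : ∀ i, pt i ∈ ls := fun i => List.getElem_mem _
  have hptL : ∀ i, pt i ∈ L := fun i => hls _ (hpt i)
  have hQL : convexHull ℝ {k | k ∈ ls} ⊆ L := convexHull_min hls h.convex_L
  -- The adversary is given mixtures of the played points in place of points of the hull: `f` is
  -- linear in the weights, hence continuous and concave in them without further argument.
  let f : Euc m → (Fin ls.length → ℝ) → ℝ := fun p μ => ∑ i, μ i * ⟪lam, u p (pt i)⟫
  have lin : ∀ p, IsLinearMap ℝ (f p) := fun p =>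
    { map_add := fun x y => by simp [f, add_mul, Finset.sum_add_distrib]
      map_smul := fun c x => by simp [f, Finset.mul_sum, mul_assoc] }
  have cont : ∀ p, Continuous (f p) := fun p => by fun_prop
  have conv : ∀ μ ∈ stdSimplex ℝ (Fin ls.length), ConvexOn ℝ P fun p => f p μ := by
    intro μ hμ
    refine ⟨h.convex_P, fun p hp q hq a b ha hb hab => le_of_eq ?_⟩
    simp only [f, smul_eq_mul, Finset.mul_sum, ← Finset.sum_add_distrib]
    refine Finset.sum_congr rfl fun i _ => ?_
    rw [h.biaffine.left _ (hptL i) p hp q hq a b ha hb hab, inner_add_right, inner_smul_right,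
      inner_smul_right]
    ring
  obtain ⟨a, haP, μ, hμ, hsad⟩ := Sion.exists_isSaddlePointOn (X := P)
    (Y := stdSimplex ℝ (Fin ls.length)) (f := f) ⟨0, h.zero_mem⟩ h.convex_P h.compact_P
    (fun μ _ => ContinuousOn.lowerSemicontinuousOn
      (continuousOn_finsetSum _ fun i _ => (h.continuousOn_inner hlam (hptL i)).const_mul _))
    (fun μ hμ => (conv μ hμ).quasiconvexOn)
    (convex_stdSimplex ℝ _) ⟨_, single_mem_stdSimplex ℝ (⟨0, hlen⟩ : Fin ls.length)⟩
    (isCompact_stdSimplex ℝ _)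
    (fun p _ => (cont p).upperSemicontinuous.upperSemicontinuousOn _)
    (fun p _ => (((lin p).mk' _).concaveOn (convex_stdSimplex ℝ _)).quasiconcaveOn)
  have hmax : ∀ i, ⟪lam, u a (pt i)⟫ ≤ f a μ := fun i => by
    have := hsad a haP _ (single_mem_stdSimplex ℝ i)
    simpa [f, Pi.single_apply] using this
  let lo : Euc n → ℝ := fun k => sInf ((fun p => ⟪lam, u p k⟫) '' P)
  have hup : ∀ k ∈ convexHull ℝ {k | k ∈ ls}, lo k ≤ f a μ := by
    intro k hk
    obtain ⟨l, hl, hle⟩ := ((h.convexOn_right lam haP).subset hQL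
      (convex_convexHull ℝ _)).exists_ge_of_mem_convexHull (subset_convexHull ℝ _) hk
    obtain ⟨i, hi⟩ := List.get_of_mem hl
    refine (csInf_le (h.bddBelow hlam (hQL hk)) ⟨a, haP, rfl⟩).trans (hle.trans ?_)
    rw [← hi]
    exact hmax i
  have hstar : ∑ i, μ i • pt i ∈ convexHull ℝ {k | k ∈ ls} :=
    (convex_convexHull ℝ _).sum_mem (fun i _ => hμ.1 i) hμ.2
      fun i _ => subset_convexHull ℝ _ (hpt i)
  have hlow : f a μ ≤ lo (∑ i, μ i • pt i) := by
    refine le_csInf (Set.Nonempty.image _ ⟨0, h.zero_mem⟩) ?_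
    rintro _ ⟨p, hp, rfl⟩
    refine (hsad p hp μ hμ).trans ?_
    have := (h.concaveOn_right lam hp).le_map_sum (t := Finset.univ) (fun i _ => hμ.1 i) hμ.2
      fun i _ => hptL i
    simpa [f] using this
  -- A selector is constrained only where a maximin point exists; the barycentre of the saddle
  -- weights is one.
  obtain ⟨hmem, hsel'⟩ := hsel ls lam ⟨_, hstar, fun k hk => (hup k hk).trans hlow⟩
  refine ⟨hmem, a, haP, fun l hl => ?_⟩
  obtain ⟨i, hi⟩ := List.get_of_mem hl
  rw [← hi]
  calc ⟪lam, u a (pt i)⟫ ≤ f a μ := hmax i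
    _ ≤ lo (∑ i, μ i • pt i) := hlow
    _ ≤ lo (sel ls lam) := hsel' hstar
    _ ≤ _ := csInf_le (h.bddBelow hlam (hQL hmem)) ⟨_, h.response_mem _ (hQL hmem), rfl⟩

end Biaffine

/-! ### Mirror steps over the truncated simplex -/

section Mirror

variable {ι : Type} [Fintype ι] {n : ℕ}

lemma argminOn_spec {X : Type} [Nonempty X] {f : X → ℝ} {S : Set X}
    (h : ∃ w ∈ S, IsMinOn f S w) : argminOn f S ∈ S ∧ IsMinOn f S (argminOn f S) :=
  Classical.epsilon_spec (p := fun w => w ∈ S ∧ IsMinOn f S w) h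

lemma uniform_mem_truncatedSimplex [Nonempty ι] (hn : 0 < n) :
    (fun _ : ι => 1 / (Fintype.card ι : ℝ)) ∈ truncatedSimplex ι n := by
  have hc : (0 : ℝ) < Fintype.card ι := by exact_mod_cast Fintype.card_pos
  have hn' : (1 : ℝ) ≤ n := by exact_mod_cast hn
  refine ⟨fun _ => ?_, by simp [hc.ne']⟩
  exact one_div_le_one_div_of_le hc (le_mul_of_one_le_right hc.le hn')

lemma pos_of_mem_truncatedSimplex [Nonempty ι] (hn : 0 < n) {w : ι → ℝ}
    (hw : w ∈ truncatedSimplex ι n) (i : ι) : 0 < w i := by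
  have hc : (0 : ℝ) < Fintype.card ι := by exact_mod_cast Fintype.card_pos
  exact lt_of_lt_of_le (by positivity) (hw.1 i)

lemma le_one_of_mem_truncatedSimplex [Nonempty ι] (hn : 0 < n) {w : ι → ℝ}
    (hw : w ∈ truncatedSimplex ι n) (i : ι) : w i ≤ 1 := by
  rw [← hw.2]
  exact Finset.single_le_sum (fun j _ => (pos_of_mem_truncatedSimplex hn hw j).le)
    (Finset.mem_univ i)

lemma convex_truncatedSimplex : Convex ℝ (truncatedSimplex ι n) := by
  intro x hx y hy a b ha hb hab
  refine ⟨fun i => ?_, ?_⟩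
  · have h1 := mul_le_mul_of_nonneg_left (hx.1 i) ha
    have h2 := mul_le_mul_of_nonneg_left (hy.1 i) hb
    simp only [Pi.add_apply, Pi.smul_apply, smul_eq_mul]
    calc _ = a * (1 / ((Fintype.card ι : ℝ) * n)) + b * (1 / ((Fintype.card ι : ℝ) * n)) := by
          rw [← add_mul, hab, one_mul]
      _ ≤ _ := add_le_add h1 h2
  · simp [Finset.sum_add_distrib, ← Finset.mul_sum, hx.2, hy.2, hab]

lemma isCompact_truncatedSimplex : IsCompact (truncatedSimplex ι n) := by
  have hsub : truncatedSimplex ι n ⊆ stdSimplex ℝ ι := fun w hw =>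
    ⟨fun i => le_trans (by positivity) (hw.1 i), hw.2⟩
  refine (isCompact_stdSimplex ℝ ι).of_isClosed_subset ?_ hsub
  have hset : truncatedSimplex ι n =
      (⋂ i, {w | 1 / ((Fintype.card ι : ℝ) * n) ≤ w i}) ∩ {w | ∑ i, w i = 1} := by
    ext; simp [truncatedSimplex]
  rw [hset]
  exact (isClosed_iInter fun i => isClosed_le continuous_const (continuous_apply i)).inter
    (isClosed_eq (by fun_prop) continuous_const)

lemma continuous_mul_log_div (v : ℝ) : Continuous fun x : ℝ => x * Real.log (x / v) := by
  rcases eq_or_ne v 0 with rfl | hv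
  · simpa using continuous_const
  have : (fun x : ℝ => x * Real.log (x / v)) = fun x => v * (x / v * Real.log (x / v)) := by
    funext x; field_simp
  rw [this]
  exact continuous_const.mul (Real.continuous_mul_log.comp (continuous_id.div_const v))

lemma continuous_weightedKL_left (η v : ι → ℝ) : Continuous fun w => weightedKL η w v := by
  unfold weightedKL
  refine continuous_finsetSum _ fun i _ => continuous_const.mul ?_
  exact (((continuous_mul_log_div (v i)).comp (continuous_apply i)).sub
    (continuous_apply i)).add continuous_const

lemma mirrorStep_spec [Nonempty ι] (hn : 0 < n) (η c v : ι → ℝ) :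
    mirrorStep n η c v ∈ truncatedSimplex ι n ∧
      IsMinOn (fun w : ι → ℝ => ∑ i, w i * c i + weightedKL η w v) (truncatedSimplex ι n)
        (mirrorStep n η c v) := by
  refine argminOn_spec (isCompact_truncatedSimplex.exists_isMinOn
    ⟨_, uniform_mem_truncatedSimplex hn⟩ (Continuous.continuousOn ?_))
  exact (by fun_prop : Continuous fun w : ι → ℝ => ∑ i, w i * c i).add
    (continuous_weightedKL_left η v)

lemma mirrorStep_mem [Nonempty ι] (hn : 0 < n) (η c v : ι → ℝ) :
    mirrorStep n η c v ∈ truncatedSimplex ι n := (mirrorStep_spec hn η c v).1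

lemma mul_log_div_sub_add_nonneg {x v : ℝ} (hx : 0 < x) (hv : 0 < v) :
    0 ≤ x * Real.log (x / v) - x + v := by
  have h := Real.log_le_sub_one_of_pos (div_pos hv hx)
  have e : Real.log (x / v) = -Real.log (v / x) := by rw [← Real.log_inv, inv_div]
  have : x * Real.log (v / x) ≤ x * (v / x - 1) := mul_le_mul_of_nonneg_left h hx.le
  rw [mul_sub, mul_div_cancel₀ _ hx.ne'] at this
  rw [e]; linarith

lemma weightedKL_nonneg {η w v : ι → ℝ} (hη : ∀ i, 0 < η i) (hw : ∀ i, 0 < w i)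
    (hv : ∀ i, 0 < v i) : 0 ≤ weightedKL η w v :=
  Finset.sum_nonneg fun i _ =>
    mul_nonneg (inv_nonneg.2 (hη i).le) (mul_log_div_sub_add_nonneg (hw i) (hv i))

/-- The Jensen gap of a Bregman divergence is the averaged divergence to the mixture. This exact
identity replaces differentiation in the three-point inequality. -/
lemma weightedKL_mix (η : ι → ℝ) {w u v : ι → ℝ} (hw : ∀ i, 0 < w i) (hu : ∀ i, 0 < u i)
    (hv : ∀ i, 0 < v i) {a b : ℝ} (ha : 0 ≤ a) (hb : 0 ≤ b) (hab : a + b = 1) :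
    weightedKL η (a • w + b • u) v = a * weightedKL η w v + b * weightedKL η u v
      - a * weightedKL η w (a • w + b • u) - b * weightedKL η u (a • w + b • u) := by
  simp only [weightedKL, Finset.mul_sum, ← Finset.sum_add_distrib, ← Finset.sum_sub_distrib]
  refine Finset.sum_congr rfl fun i _ => ?_
  have hz : 0 < (a • w + b • u) i := by
    simp only [Pi.add_apply, Pi.smul_apply, smul_eq_mul]
    rcases eq_or_lt_of_le ha with rfl | ha
    · simp_all
    · exact add_pos_of_pos_of_nonneg (mul_pos ha (hw i)) (mul_nonneg hb (hu i).le)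
  rw [Real.log_div hz.ne' (hv i).ne', Real.log_div (hw i).ne' (hv i).ne',
    Real.log_div (hu i).ne' (hv i).ne', Real.log_div (hw i).ne' hz.ne',
    Real.log_div (hu i).ne' hz.ne']
  have hb' : b = 1 - a := by linarith
  simp only [Pi.add_apply, Pi.smul_apply, smul_eq_mul, hb']
  ring

/-- The three-point inequality for a mirror step. -/
theorem mirrorStep_three_point [Nonempty ι] (hn : 0 < n) {η : ι → ℝ} (hη : ∀ i, 0 < η i)
    (c : ι → ℝ) {v : ι → ℝ} (hv : ∀ i, 0 < v i) {u : ι → ℝ} (hu : u ∈ truncatedSimplex ι n) :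
    ∑ i, (mirrorStep n η c v i - u i) * c i ≤ weightedKL η u v
      - weightedKL η u (mirrorStep n η c v) - weightedKL η (mirrorStep n η c v) v := by
  obtain ⟨hw, hmin⟩ := mirrorStep_spec hn η c v
  set w := mirrorStep n η c v
  have hwp := pos_of_mem_truncatedSimplex hn hw
  have hup := pos_of_mem_truncatedSimplex hn hu
  let z : ℝ → ι → ℝ := fun ε => (1 - ε) • w + ε • u
  -- The minimizer w is compared with the point z ε of the segment towards u; after division by ε,
  -- letting ε → 0 plays the role of the first-order optimality condition.
  have key : ∀ ε ∈ Set.Ioo (0 : ℝ) 1, weightedKL η u (z ε) ≤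
      ∑ i, (u i - w i) * c i + weightedKL η u v - weightedKL η w v := by
    rintro ε ⟨h0, h1⟩
    have hz : z ε ∈ truncatedSimplex ι n :=
      convex_truncatedSimplex hw hu (by linarith) h0.le (by ring)
    have h := hmin hz
    simp only [Set.mem_ofPred_eq] at h
    have hmix := weightedKL_mix η hwp hup hv (a := 1 - ε) (b := ε) (by linarith) h0.le (by ring)
    have hnn := weightedKL_nonneg hη hwp (pos_of_mem_truncatedSimplex hn hz)
    have hlin : ∑ i, z ε i * c i = ∑ i, w i * c i + ε * ∑ i, (u i - w i) * c i := by
      rw [Finset.mul_sum, ← Finset.sum_add_distrib]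
      refine Finset.sum_congr rfl fun i _ => ?_
      simp only [z, Pi.add_apply, Pi.smul_apply, smul_eq_mul]
      ring
    change weightedKL η (z ε) v = (1 - ε) * weightedKL η w v + ε * weightedKL η u v
      - (1 - ε) * weightedKL η w (z ε) - ε * weightedKL η u (z ε) at hmix
    rw [hlin, hmix] at h
    have h2 : 0 ≤ (1 - ε) * weightedKL η w (z ε) := mul_nonneg (by linarith) hnn
    have h3 : ε * weightedKL η u (z ε) ≤ ε * (∑ i, (u i - w i) * c i + weightedKL η u v
      - weightedKL η w v) := by linarith
    exact le_of_mul_le_mul_left h3 h0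
  have hz0 : z 0 = w := by simp [z]
  have hcont : Filter.Tendsto (fun ε => weightedKL η u (z ε)) (nhdsWithin 0 (Set.Ioi 0))
      (nhds (weightedKL η u w)) := by
    have hzc : Continuous z := by fun_prop
    have hca : ContinuousAt (fun ε => weightedKL η u (z ε)) 0 := by
      unfold weightedKL
      refine tendsto_finsetSum _ fun i _ => ?_
      have hzi : ContinuousAt (fun ε => z ε i) 0 := (continuous_apply i).comp hzc |>.continuousAt
      have hz0i : z 0 i ≠ 0 := by rw [hz0]; exact (hwp i).ne'
      have : ContinuousAt (fun ε => Real.log (u i / z ε i)) 0 :=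
        (continuousAt_const.div hzi hz0i).log (div_ne_zero (hup i).ne' hz0i)
      exact continuousAt_const.mul (((continuousAt_const.mul this).sub continuousAt_const).add hzi)
    have := hca.tendsto.mono_left (nhdsWithin_le_nhds (s := Set.Ioi 0))
    rwa [hz0] at this
  have hlim := le_of_tendsto hcont
    (Filter.eventually_of_mem (Ioo_mem_nhdsGT (zero_lt_one' ℝ)) key)
  have hneg : ∑ i, (w i - u i) * c i = -∑ i, (u i - w i) * c i := by
    rw [← Finset.sum_neg_distrib]
    exact Finset.sum_congr rfl fun i _ => by ring
  linarith

/-- For fixed w the left side is largest at v = w exp(-ηx), with value η⁻¹ w (exp(-ηx) - 1 + ηx).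
The bound |exp y - 1 - y| ≤ y² for |y| ≤ 1 finishes. The maximization is encoded by log s ≤ s - 1 at
s = w exp(-ηx)/v. -/
lemma sub_mul_sub_mul_log_le {w v x η : ℝ} (hw : 0 < w) (hv : 0 < v) (hη : 0 < η)
    (hx : |η * x| ≤ 1) :
    (w - v) * x - η⁻¹ * (v * Real.log (v / w) - v + w) ≤ η * w * x ^ 2 := by
  have h1 := Real.log_le_sub_one_of_pos (div_pos (mul_pos hw (Real.exp_pos (-(η * x)))) hv)
  rw [Real.log_div (by positivity) hv.ne', Real.log_mul hw.ne' (Real.exp_pos _).ne',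
    Real.log_exp] at h1
  have h2 := mul_le_mul_of_nonneg_left h1 hv.le
  rw [mul_sub v (_ / v), mul_div_cancel₀ _ hv.ne', mul_one] at h2
  have h3 := (abs_le.1 (Real.abs_exp_sub_one_sub_id_le (x := -(η * x)) (by rwa [abs_neg]))).2
  have h4 := mul_le_mul_of_nonneg_left h3 hw.le
  rw [Real.log_div hv.ne' hw.ne']
  have h5 : η * ((w - v) * x - η⁻¹ * (v * (Real.log v - Real.log w) - v + w)) ≤
      η * (η * w * x ^ 2) := by
    rw [mul_sub, mul_inv_cancel_left₀ hη.ne']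
    nlinarith
  exact le_of_mul_le_mul_left h5 hη

/-- One round of optimistic mirror descent with second-order correction. -/
theorem optimistic_step [Nonempty ι] (hn : 0 < n) {η : ι → ℝ} (hη : ∀ i, 0 < η i)
    (hη' : ∀ i, η i ≤ 1 / 64) {m y v : ι → ℝ} (hmy : ∀ i, |y i - m i| ≤ 2)
    (hv : v ∈ truncatedSimplex ι n) {u : ι → ℝ} (hu : u ∈ truncatedSimplex ι n) :
    ∑ i, (mirrorStep n η m v i - u i) * y i ≤ weightedKL η u v
      - weightedKL η u (mirrorStep n η (fun i => y i + 32 * η i * (y i - m i) ^ 2) v)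
      + ∑ i, u i * (32 * η i * (y i - m i) ^ 2) := by
  have hvp := pos_of_mem_truncatedSimplex hn hv
  have hw := mirrorStep_mem hn η m v
  have hw' := mirrorStep_mem hn η (fun i => y i + 32 * η i * (y i - m i) ^ 2) v
  have h1 := mirrorStep_three_point hn hη m hvp hw'
  have h2 := mirrorStep_three_point hn hη (fun i => y i + 32 * η i * (y i - m i) ^ 2) hvp hu
  set w := mirrorStep n η m v
  set w' := mirrorStep n η (fun i => y i + 32 * η i * (y i - m i) ^ 2) v
  have hwp := pos_of_mem_truncatedSimplex hn hw
  have hwp' := pos_of_mem_truncatedSimplex hn hw'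
  have hD := weightedKL_nonneg hη hwp hvp
  -- The stability term is absorbed by the correction a = 32η(y - m)²: as 32η|y - m| ≤ 1, the vector
  -- y - m + a is at most 2|y - m| entrywise, and 4 ≤ 32.
  have h3 : ∑ i, (w i - w' i) * (y i - m i + 32 * η i * (y i - m i) ^ 2) - weightedKL η w' w ≤
      ∑ i, w i * (32 * η i * (y i - m i) ^ 2) := by
    rw [weightedKL, ← Finset.sum_sub_distrib]
    refine Finset.sum_le_sum fun i _ => ?_
    set δ := y i - m i
    have hδ := hmy i
    have hx : |δ + 32 * η i * δ ^ 2| ≤ 2 * |δ| := by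
      have e : δ + 32 * η i * δ ^ 2 = δ * (1 + 32 * η i * δ) := by ring
      rw [e, abs_mul, mul_comm]
      refine mul_le_mul_of_nonneg_right ?_ (abs_nonneg δ)
      have h32 : |32 * η i * δ| ≤ 1 := by
        rw [abs_mul, abs_of_pos (by linarith [hη i] : 0 < 32 * η i)]
        have := hη i
        have := hη' i
        nlinarith [abs_nonneg δ]
      have := abs_le.1 h32
      exact abs_le.2 ⟨by linarith, by linarith⟩
    have hηx : |η i * (δ + 32 * η i * δ ^ 2)| ≤ 1 := by
      rw [abs_mul, abs_of_pos (hη i)]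
      calc _ ≤ 1 / 64 * (2 * |δ|) := mul_le_mul (hη' i) hx (abs_nonneg _) (by norm_num)
        _ ≤ 1 := by linarith
    refine (sub_mul_sub_mul_log_le (hwp i) (hwp' i) (hη i) hηx).trans ?_
    have hsq : (δ + 32 * η i * δ ^ 2) ^ 2 ≤ 4 * δ ^ 2 := by
      have := pow_le_pow_left₀ (abs_nonneg _) hx 2
      rw [sq_abs, mul_pow, sq_abs] at this
      linarith
    have hpos : 0 ≤ η i * w i := (mul_pos (hη i) (hwp i)).le
    calc η i * w i * (δ + 32 * η i * δ ^ 2) ^ 2 ≤ η i * w i * (4 * δ ^ 2) :=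
          mul_le_mul_of_nonneg_left hsq hpos
      _ ≤ η i * w i * (32 * δ ^ 2) := mul_le_mul_of_nonneg_left (by nlinarith [sq_nonneg δ]) hpos
      _ = _ := by ring
  -- The correction cancels on the learner's side and survives only as ⟨u, a⟩, at the comparator;
  -- the divergence of w' from v cancels between the two mirror steps.
  have e : ∑ i, (w i - u i) * y i = ∑ i, (w i - w' i) * m i
      + ∑ i, (w' i - u i) * (y i + 32 * η i * (y i - m i) ^ 2)
      + ∑ i, (w i - w' i) * (y i - m i + 32 * η i * (y i - m i) ^ 2)
      - ∑ i, w i * (32 * η i * (y i - m i) ^ 2) + ∑ i, u i * (32 * η i * (y i - m i) ^ 2) := by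
    simp only [← Finset.sum_add_distrib, ← Finset.sum_sub_distrib]
    exact Finset.sum_congr rfl fun i _ => by ring
  linarith

end Mirror

/-! ### MsMwC against slowly increasing losses -/

section MsMwC

variable {ι : Type} [Fintype ι] {n : ℕ}

lemma msMwC_aux_mem [Nonempty ι] (hn : 0 < n) (b : ℕ → ι → ℝ) (t : ℕ) :
    ((msMwC ι n).stateAt b t).aux ∈ truncatedSimplex ι n := by
  cases t with
  | zero => exact uniform_mem_truncatedSimplex hn
  | succ t => exact mirrorStep_mem hn _ _ _

lemma msMwC_play_mem [Nonempty ι] (hn : 0 < n) (b : ℕ → ι → ℝ) (t : ℕ) :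
    (msMwC ι n).play b t ∈ truncatedSimplex ι n := mirrorStep_mem hn _ _ _

/-- The quantity 3 + 2·pred serves as a potential. The first loss satisfies b² ≤ 1 ≤ 3 + 2b, and
every later increment Δ lies in [0, 2], so Δ² ≤ 2Δ. Since pred ≤ 1, the sum of squares never exceeds
5. -/
lemma msMwC_dev_le {b : ℕ → ι → ℝ} (hb : ∀ t i, |b t i| ≤ 1) (hmono : Monotone b) (t : ℕ)
    (i : ι) : ((msMwC ι n).stateAt b t).dev i ≤ 3 + 2 * ((msMwC ι n).stateAt b t).pred i ∧
      |b t i - ((msMwC ι n).stateAt b t).pred i| ≤ 2 := by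
  induction t with
  | zero =>
    simp only [OnlineAlgorithm.stateAt, msMwC]
    refine ⟨by norm_num, ?_⟩
    rw [sub_zero]; linarith [hb 0 i]
  | succ t ih =>
    have h1 := abs_le.1 (hb t i)
    have h2 := abs_le.1 (hb (t + 1) i)
    have hle : b t i ≤ b (t + 1) i := hmono (Nat.le_succ t) i
    refine ⟨?_, ?_⟩
    · cases t with
      | zero =>
        simp only [OnlineAlgorithm.stateAt, msMwC]
        nlinarith
      | succ t =>
        obtain ⟨ih, -⟩ := ih
        simp only [OnlineAlgorithm.stateAt, msMwC] at ih ⊢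
        have h3 := abs_le.1 (hb t i)
        have hle' : b t i ≤ b (t + 1) i := hmono (Nat.le_succ t) i
        nlinarith
    · simp only [OnlineAlgorithm.stateAt, msMwC]
      exact abs_le.2 ⟨by linarith, by linarith⟩

/-- The cap 1/64 is active because 5/log 2 is far below 64². If |ι| n = 1 the logarithm vanishes,
and division by zero gives 0, again below the cap. -/
lemma msRate_eq [Nonempty ι] (hn : 0 < n) {s : MsMwCState ι} {i : ι} (hs : s.dev i ≤ 5) :
    msRate n s i = 1 / 64 := by
  have h : √(s.dev i / Real.log ((Fintype.card ι : ℝ) * n)) ≤ 64 := by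
    rw [Real.sqrt_le_left (by norm_num)]
    have hX : 1 ≤ Fintype.card ι * n := Nat.mul_pos Fintype.card_pos hn
    rcases hX.eq_or_lt with hX | hX
    · have : (Fintype.card ι : ℝ) * n = 1 := by exact_mod_cast hX.symm
      rw [this]; norm_num
    · have hX2 : (2 : ℝ) ≤ (Fintype.card ι : ℝ) * n := by exact_mod_cast hX
      have hlog := Real.log_le_log (by norm_num) hX2
      have := Real.log_two_gt_d9
      rw [div_le_iff₀ (by linarith)]
      nlinarith
  rw [msRate, max_eq_left h, one_div]

lemma msMwC_rate [Nonempty ι] {b : ℕ → ι → ℝ} (hn : 0 < n) (hb : ∀ t i, |b t i| ≤ 1) (hmono : Monotone b)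
    (t : ℕ) : msRate n ((msMwC ι n).stateAt b t) = fun _ => 1 / 64 := by
  funext i
  refine msRate_eq hn ?_
  have hp : ((msMwC ι n).stateAt b t).pred i ≤ 1 := by
    cases t with
    | zero => simp [OnlineAlgorithm.stateAt, msMwC]
    | succ t => exact (abs_le.1 (hb t i)).2
  linarith [(msMwC_dev_le (n := n) hb hmono t i).1]

lemma msMwC_regret_truncated [Nonempty ι] {b : ℕ → ι → ℝ} (hn : 0 < n) (hb : ∀ t i, |b t i| ≤ 1)
    (hmono : Monotone b) {w : ι → ℝ} (hw : w ∈ truncatedSimplex ι n) (k : ℕ) :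
    ∑ t ∈ Finset.range k, ∑ i, ((msMwC ι n).play b t i - w i) * b t i ≤
      64 * Real.log (Fintype.card ι) + 5 / 2 := by
  have hwp := pos_of_mem_truncatedSimplex hn hw
  have hc : (0 : ℝ) < Fintype.card ι := by exact_mod_cast Fintype.card_pos
  obtain ⟨η, hη64⟩ : ∃ η : ι → ℝ, η = fun _ => 1 / 64 := ⟨_, rfl⟩
  have hη : ∀ i, 0 < η i := fun _ => by norm_num [hη64]
  obtain ⟨s, hs⟩ : ∃ s : ℕ → MsMwCState ι, ∀ t, s t = (msMwC ι n).stateAt b t :=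
    ⟨_, fun _ => rfl⟩
  have hrate : ∀ t, msRate n (s t) = η := fun t => by rw [hs, hη64]; exact msMwC_rate hn hb hmono t
  have haux : ∀ t, (s t).aux ∈ truncatedSimplex ι n := fun t => by
    rw [hs]; exact msMwC_aux_mem hn b t
  have hdev : ∀ t i, (s t).dev i ≤ 3 + 2 * (s t).pred i ∧ |b t i - (s t).pred i| ≤ 2 :=
    fun t i => by rw [hs]; exact msMwC_dev_le hb hmono t i
  have hplay : ∀ t, (msMwC ι n).play b t = mirrorStep n η (s t).pred (s t).aux := fun t => by
    rw [← hrate t, hs]; rfl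
  have hsucc : ∀ t, (s (t + 1)).aux = mirrorStep n η
      (fun i => b t i + 32 * η i * (b t i - (s t).pred i) ^ 2) (s t).aux := fun t => by
    rw [← hrate t, hs, hs]; rfl
  have hdevs : ∀ t i, (s (t + 1)).dev i = (s t).dev i + (b t i - (s t).pred i) ^ 2 :=
    fun t i => by rw [hs, hs]; rfl
  have hzero : s 0 = ⟨fun _ => 1 / (Fintype.card ι : ℝ), fun _ => 0, fun _ => 0⟩ := by
    rw [hs]; rfl
  -- Constant learning rates make the divergences telescope; the factor 1/2 is 32 · (1/64) from the
  -- correction.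
  have main : ∑ t ∈ Finset.range k, ∑ i, ((msMwC ι n).play b t i - w i) * b t i ≤
      weightedKL η w (fun _ => 1 / (Fintype.card ι : ℝ)) - weightedKL η w (s k).aux
        + 1 / 2 * ∑ i, w i * (s k).dev i := by
    induction k with
    | zero => simp [hzero]
    | succ k ih =>
      rw [Finset.sum_range_succ]
      have hstep := optimistic_step hn hη (fun _ => by simp [hη64]) (fun i => (hdev k i).2) (haux k) hw
      rw [← hplay, ← hsucc] at hstep
      have e4 : 1 / 2 * ∑ i, w i * (s (k + 1)).dev i = 1 / 2 * ∑ i, w i * (s k).dev i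
          + ∑ i, w i * (32 * η i * (b k i - (s k).pred i) ^ 2) := by
        simp only [hdevs, mul_add, Finset.sum_add_distrib, Finset.mul_sum]
        congr 1
        exact Finset.sum_congr rfl fun i _ => by simp only [hη64]; ring
      linarith
  have h1 : weightedKL η w (fun _ => 1 / (Fintype.card ι : ℝ)) ≤
      64 * Real.log (Fintype.card ι) := by
    have e : weightedKL η w (fun _ => 1 / (Fintype.card ι : ℝ)) =
        64 * ∑ i, w i * (Real.log (w i) + Real.log (Fintype.card ι)) := by
      have : ∀ i, (η i)⁻¹ * (w i * Real.log (w i / (1 / (Fintype.card ι : ℝ))) - w i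
          + 1 / (Fintype.card ι : ℝ)) = 64 * (w i * (Real.log (w i) + Real.log (Fintype.card ι)))
          - 64 * w i + 64 * (1 / (Fintype.card ι : ℝ)) := fun i => by
        rw [div_div_eq_mul_div, div_one, Real.log_mul (hwp i).ne' hc.ne']
        simp only [hη64]; ring
      simp only [weightedKL, this, Finset.sum_add_distrib, Finset.sum_sub_distrib,
        ← Finset.mul_sum, hw.2]
      simp [hc.ne']
    rw [e]
    refine mul_le_mul_of_nonneg_left ?_ (by norm_num)
    calc ∑ i, w i * (Real.log (w i) + Real.log (Fintype.card ι)) ≤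
          ∑ i, w i * Real.log (Fintype.card ι) := by
          refine Finset.sum_le_sum fun i _ => mul_le_mul_of_nonneg_left ?_ (hwp i).le
          linarith [Real.log_nonpos (hwp i).le (le_one_of_mem_truncatedSimplex hn hw i)]
      _ = _ := by rw [← Finset.sum_mul, hw.2, one_mul]
  have h2 : ∑ i, w i * (s k).dev i ≤ 5 := by
    calc _ ≤ ∑ i, w i * 5 := by
          refine Finset.sum_le_sum fun i _ => mul_le_mul_of_nonneg_left ?_ (hwp i).le
          have hp : (s k).pred i ≤ 1 := by
            cases k with
            | zero => simp [hzero]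
            | succ t => rw [hs]; exact (abs_le.1 (hb t i)).2
          linarith [(hdev k i).1]
      _ = 5 := by rw [← Finset.sum_mul, hw.2, one_mul]
  have h3 := weightedKL_nonneg hη hwp (pos_of_mem_truncatedSimplex hn (haux k))
  linarith

/-- Regret of MsMwC against losses in `[-1, 1]` that increase with time. -/
theorem msMwC_regret [Nonempty ι] {b : ℕ → ι → ℝ} (hn : 0 < n) (hb : ∀ t i, |b t i| ≤ 1)
    (hmono : Monotone b) (q : ι) {k : ℕ} (hk : k ≤ n) :
    ∑ t ∈ Finset.range k, ∑ i, (msMwC ι n).play b t i * b t i ≤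
      ∑ t ∈ Finset.range k, b t q + (64 * Real.log (Fintype.card ι) + 9 / 2) := by
  classical
  have hc : (0 : ℝ) < Fintype.card ι := by exact_mod_cast Fintype.card_pos
  have hn' : (0 : ℝ) < n := by exact_mod_cast hn
  have hn1 : (n : ℝ)⁻¹ ≤ 1 := inv_le_one_of_one_le₀ (by exact_mod_cast hn)
  -- The point mass at q lies outside the truncated simplex in general, so it is mixed with 1/n of
  -- the uniform vector. This costs at most 2/n per round, hence 2 in all, which turns 5/2 into 9/2.
  let w : ι → ℝ := fun i => (1 - (n : ℝ)⁻¹) * (if i = q then 1 else 0)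
    + (n : ℝ)⁻¹ * (Fintype.card ι : ℝ)⁻¹
  have hw : w ∈ truncatedSimplex ι n := by
    refine ⟨fun i => ?_, ?_⟩
    · rw [one_div, mul_inv, mul_comm]
      have : 0 ≤ (1 - (n : ℝ)⁻¹) * (if i = q then 1 else 0) :=
        mul_nonneg (by linarith) (by split_ifs <;> norm_num)
      simp only [w]; linarith
    · simp only [w, Finset.sum_add_distrib, ← Finset.mul_sum]
      simp [hc.ne']
  have hreg := msMwC_regret_truncated hn hb hmono hw k
  have hround : ∀ t, ∑ i, w i * b t i ≤ b t q + 2 / n := by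
    intro t
    have e : ∑ i, w i * b t i = (1 - (n : ℝ)⁻¹) * b t q
        + (n : ℝ)⁻¹ * ((Fintype.card ι : ℝ)⁻¹ * ∑ i, b t i) := by
      simp only [w, add_mul, Finset.sum_add_distrib, mul_assoc, ← Finset.mul_sum]
      simp
    have hs : (Fintype.card ι : ℝ)⁻¹ * ∑ i, b t i ≤ 1 := by
      rw [inv_mul_le_iff₀ hc, mul_one]
      calc ∑ i, b t i ≤ ∑ _i : ι, (1 : ℝ) := Finset.sum_le_sum fun i _ => (abs_le.1 (hb t i)).2
        _ = _ := by simp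
    have hq := (abs_le.1 (hb t q)).1
    have hinv : 0 < (n : ℝ)⁻¹ := by positivity
    rw [e, div_eq_mul_inv]
    nlinarith
  have hsum : ∑ t ∈ Finset.range k, ∑ i, w i * b t i ≤ ∑ t ∈ Finset.range k, b t q + 2 := by
    calc _ ≤ ∑ t ∈ Finset.range k, (b t q + 2 / n) := Finset.sum_le_sum fun t _ => hround t
      _ = ∑ t ∈ Finset.range k, b t q + k * (2 / n) := by simp [Finset.sum_add_distrib]
      _ ≤ _ := by
        have : (k : ℝ) ≤ n := by exact_mod_cast hk
        have : (k : ℝ) * (2 / n) ≤ n * (2 / n) := by gcongr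
        rw [mul_div_cancel₀ _ hn'.ne'] at this
        linarith
  simp only [sub_mul, Finset.sum_sub_distrib] at hreg
  linarith

end MsMwC

/-! ### Online gradient descent on the unit ball -/

section Ogd

variable {d : ℕ}

lemma norm_projUnitBall_le (y : Euc d) : ‖projUnitBall y‖ ≤ 1 := by
  have h : 0 < max 1 ‖y‖ := lt_max_of_lt_left one_pos
  rw [projUnitBall, norm_smul, norm_inv, Real.norm_of_nonneg h.le, inv_mul_le_iff₀ h, mul_one]
  exact le_max_right _ _

/-- For ‖y‖ > 1 the squared distances differ by at least (‖y‖ - 1)², because ⟪y, z⟫ ≤ ‖y‖. -/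
lemma norm_projUnitBall_sub_le (y : Euc d) {z : Euc d} (hz : ‖z‖ ≤ 1) :
    ‖projUnitBall y - z‖ ≤ ‖y - z‖ := by
  rcases le_or_gt ‖y‖ 1 with hy | hy
  · simp [projUnitBall, max_eq_left hy]
  have hs : 0 < ‖y‖ := one_pos.trans hy
  rw [projUnitBall, max_eq_right hy.le]
  refine le_of_sq_le_sq ?_ (norm_nonneg _)
  rw [norm_sub_sq_real, norm_sub_sq_real, norm_smul, inner_smul_left, norm_inv, norm_norm,
    inv_mul_cancel₀ hs.ne']
  simp only [map_inv₀, conj_trivial]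
  have hyz : ⟪y, z⟫ ≤ ‖y‖ := (real_inner_le_norm y z).trans (mul_le_of_le_one_right hs.le hz)
  have h1 : 0 ≤ 1 - ‖y‖⁻¹ := by
    have := inv_le_one_of_one_le₀ hy.le
    linarith
  have h2 := mul_le_mul_of_nonneg_left hyz h1
  rw [sub_mul, sub_mul, inv_mul_cancel₀ hs.ne'] at h2
  nlinarith [sq_nonneg (‖y‖ - 1)]

lemma gradient_neg_inner (g x : Euc d) : gradient (fun y => -⟪y, g⟫) x = -g := by
  refine HasGradientAt.gradient ?_
  rw [hasGradientAt_iff_hasFDerivAt]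
  have h := (InnerProductSpace.toDual ℝ (Euc d) (-g)).hasFDerivAt (x := x)
  refine h.congr_of_eventuallyEq (Filter.Eventually.of_forall fun y => ?_)
  simp [real_inner_comm]

variable {x₁ : Euc d} {b : ℕ → Euc d → ℝ} {g : ℕ → Euc d}

lemma ogd_stateAt_fst (e : ℕ) : ((ogd x₁).stateAt b e).1 = e + 1 := by
  induction e with
  | zero => rfl
  | succ e ih =>
    change ((ogd x₁).stateAt b e).1 + 1 = _
    rw [ih]

lemma norm_ogd_play_le (hx : ‖x₁‖ ≤ 1) (e : ℕ) : ‖(ogd x₁).play b e‖ ≤ 1 := by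
  cases e with
  | zero => exact hx
  | succ e => exact norm_projUnitBall_le _

lemma ogd_play_succ {E e : ℕ} (he : e < E) (hb : ∀ e < E, b e = fun x => -⟪x, g e⟫) :
    (ogd x₁).play b (e + 1) =
      projUnitBall ((ogd x₁).play b e + (1 / √((e : ℝ) + 1)) • g e) := by
  change projUnitBall (((ogd x₁).stateAt b e).2 - (1 / √(((ogd x₁).stateAt b e).1 : ℝ)) •
    gradient (b e) ((ogd x₁).stateAt b e).2) = _
  rw [ogd_stateAt_fst, hb e he, gradient_neg_inner, smul_neg, sub_neg_eq_add]
  push_cast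
  rfl

/-- Regret of online gradient descent against linear gains. -/
theorem ogd_regret (hx : ‖x₁‖ ≤ 1) {E : ℕ} (hb : ∀ e < E, b e = fun x => -⟪x, g e⟫)
    (hg : ∀ e < E, ‖g e‖ ≤ 2) {z : Euc d} (hz : ‖z‖ ≤ 1) :
    ∑ e ∈ Finset.range E, ⟪z - (ogd x₁).play b e, g e⟫ ≤ 6 * √E := by
  have hD : ∀ e, ‖(ogd x₁).play b e - z‖ ^ 2 ≤ 4 := fun e => by
    have h1 := norm_sub_le ((ogd x₁).play b e) z
    have h2 := norm_ogd_play_le (b := b) hx e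
    nlinarith [norm_nonneg ((ogd x₁).play b e - z)]
  -- Summation by parts as an invariant: the weight √k of the squared distance grows with k, and 4
  -- is the squared diameter. At k = E the right side is at most 12√E.
  have main : ∀ k ≤ E, 2 * ∑ e ∈ Finset.range k, ⟪z - (ogd x₁).play b e, g e⟫ ≤
      √k * (4 - ‖(ogd x₁).play b k - z‖ ^ 2) + 8 * √k := by
    intro k hk
    induction k with
    | zero => simp
    | succ k ih =>
      specialize ih (by omega)
      have hgk := hg k hk
      rw [Finset.sum_range_succ]
      push_cast
      have hs : 0 < √((k : ℝ) + 1) := Real.sqrt_pos.2 (by positivity)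
      have hsk := Real.sqrt_nonneg (k : ℝ)
      have hss : √((k : ℝ) + 1) ^ 2 = k + 1 := Real.sq_sqrt (by positivity)
      have hsks : √(k : ℝ) ^ 2 = k := Real.sq_sqrt (by positivity)
      have hle : √(k : ℝ) ≤ √((k : ℝ) + 1) := Real.sqrt_le_sqrt (by linarith)
      set s := √((k : ℝ) + 1)
      set r := √(k : ℝ)
      set x := (ogd x₁).play b k
      have hstep : ‖(ogd x₁).play b (k + 1) - z‖ ^ 2 ≤
          ‖x - z‖ ^ 2 - 2 * (1 / s) * ⟪z - x, g k⟫ + (1 / s) ^ 2 * 4 := by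
        have h1 : ‖(ogd x₁).play b (k + 1) - z‖ ≤ ‖(x - z) + (1 / s) • g k‖ := by
          rw [ogd_play_succ hk hb, sub_add_eq_add_sub]
          exact norm_projUnitBall_sub_le _ hz
        have h2 := pow_le_pow_left₀ (norm_nonneg _) h1 2
        rw [norm_add_sq_real, inner_smul_right, norm_smul, mul_pow, Real.norm_eq_abs, sq_abs] at h2
        have h3 : ⟪x - z, g k⟫ = -⟪z - x, g k⟫ := by rw [← inner_neg_left, neg_sub]
        have h4 : ‖g k‖ ^ 2 ≤ 4 := by nlinarith [norm_nonneg (g k)]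
        have h5 := mul_le_mul_of_nonneg_left h4 (sq_nonneg (1 / s))
        rw [h3] at h2
        linarith
      have h6 := mul_le_mul_of_nonneg_left hstep hs.le
      have e6 : s * (‖x - z‖ ^ 2 - 2 * (1 / s) * ⟪z - x, g k⟫ + (1 / s) ^ 2 * 4) =
          s * ‖x - z‖ ^ 2 - 2 * ⟪z - x, g k⟫ + 4 / s := by field_simp
      rw [e6] at h6
      have h7 : r * (4 - ‖x - z‖ ^ 2) ≤ s * (4 - ‖x - z‖ ^ 2) :=
        mul_le_mul_of_nonneg_right hle (by linarith [hD k])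
      -- Here (s - r)(s + r) = 1 and s + r ≤ 2s.
      have h8 : 4 / s ≤ 8 * (s - r) := by
        rw [div_le_iff₀ hs]
        nlinarith [sq_nonneg (s - r)]
      linarith
  have h := main E le_rfl
  have h9 : √(E : ℝ) * (4 - ‖(ogd x₁).play b E - z‖ ^ 2) ≤ √(E : ℝ) * 4 :=
    mul_le_mul_of_nonneg_left (by linarith [sq_nonneg ‖(ogd x₁).play b E - z‖])
      (Real.sqrt_nonneg _)
  linarith

end Ogd

/-! ### The states of the epoch-based learner -/

/-- The first `k` values of `f`, most recent first. -/
def recent {α : Type} (f : ℕ → α) : ℕ → List α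
  | 0 => []
  | k + 1 => f k :: recent f k

section Recent

variable {α β : Type} (f : ℕ → α)

lemma length_recent (k : ℕ) : (recent f k).length = k := by
  induction k with
  | zero => rfl
  | succ k ih => simp [recent, ih]

lemma map_recent (g : α → β) (k : ℕ) : (recent f k).map g = recent (fun i => g (f i)) k := by
  induction k with
  | zero => rfl
  | succ k ih => simp [recent, ih]

lemma mem_recent {k : ℕ} {x : α} : x ∈ recent f k ↔ ∃ i < k, f i = x := by
  induction k with
  | zero => simp [recent]
  | succ k ih =>
    simp only [recent, List.mem_cons, ih, Nat.lt_succ_iff_lt_or_eq]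
    constructor
    · rintro (rfl | ⟨i, hi, rfl⟩)
      · exact ⟨k, Or.inr rfl, rfl⟩
      · exact ⟨i, Or.inl hi, rfl⟩
    · rintro ⟨i, hi | rfl, rfl⟩
      · exact Or.inr ⟨i, hi, rfl⟩
      · exact Or.inl rfl

lemma sum_recent {E : Type} [AddCommMonoid E] (f : ℕ → E) (k : ℕ) :
    (recent f k).sum = ∑ i ∈ Finset.range k, f i := by
  induction k with
  | zero => rfl
  | succ k ih => rw [recent, List.sum_cons, ih, Finset.sum_range_succ, add_comm]

end Recent

lemma OnlineAlgorithm.stateAt_congr {A B : Type} (alg : OnlineAlgorithm A B) {b b' : ℕ → B}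
    {t : ℕ} (h : ∀ s < t, b s = b' s) : alg.stateAt b t = alg.stateAt b' t := by
  induction t with
  | zero => rfl
  | succ t ih =>
    simp only [OnlineAlgorithm.stateAt, h t (Nat.lt_succ_self t),
      ih fun s hs => h s (Nat.lt_succ_of_lt hs)]

lemma OnlineAlgorithm.play_congr {A B : Type} (alg : OnlineAlgorithm A B) {b b' : ℕ → B}
    {t : ℕ} (h : ∀ s < t, b s = b' s) : alg.play b t = alg.play b' t :=
  congrArg alg.act (alg.stateAt_congr h)

section EpochStates

variable {m n d : ℕ} (u : Euc m → Euc n → Euc d)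
  (outer : OnlineAlgorithm (Euc d) (Euc d → ℝ)) (inner : OnlineAlgorithm (Euc m) (Euc m → ℝ))
  (F : List (Euc n) → Euc d → Euc m → ℝ) (U : List (Euc n) → Euc d → Euc d) (Te : ℕ)
  (l : ℕ → Euc n)

lemma epochLearner_stateAt_add {t₀ : ℕ} {o : outer.State}
    (h₀ : (epochLearner u outer inner F U Te).stateAt l t₀ = EpochState.mk o inner.start [])
    {k : ℕ} (hk : k < Te) :
    (epochLearner u outer inner F U Te).stateAt l (t₀ + k) =
      EpochState.mk o
        (inner.stateAt (fun j => F (recent (fun i => l (t₀ + i)) (j + 1)) (outer.act o)) k)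
        (recent (fun i => ((epochLearner u outer inner F U Te).play l (t₀ + i), l (t₀ + i))) k) := by
  induction k with
  | zero => exact h₀
  | succ k ih =>
    specialize ih (by omega)
    have hp : (epochLearner u outer inner F U Te).play l (t₀ + k) = inner.act (inner.stateAt
        (fun j => F (recent (fun i => l (t₀ + i)) (j + 1)) (outer.act o)) k) := by
      rw [OnlineAlgorithm.play, ih]; rfl
    rw [← add_assoc]
    change (epochLearner u outer inner F U Te).update
      ((epochLearner u outer inner F U Te).stateAt l (t₀ + k)) (l (t₀ + k)) = _
    rw [ih]
    simp only [epochLearner]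
    rw [if_neg (by rw [List.length_cons, length_recent]; omega)]
    congr 1
    · change _ = inner.update _ _
      congr 1
      rw [List.map_cons, map_recent]
      rfl
    · change _ = ((epochLearner u outer inner F U Te).play l (t₀ + k), l (t₀ + k)) :: _
      rw [hp]

lemma epochLearner_stateAt_add_length {t₀ : ℕ} {o : outer.State} (hTe : 0 < Te)
    (h₀ : (epochLearner u outer inner F U Te).stateAt l t₀ = EpochState.mk o inner.start []) :
    (epochLearner u outer inner F U Te).stateAt l (t₀ + Te) =
      EpochState.mk (outer.update o fun x => -⟪x, (1 / (Te : ℝ)) • ∑ i ∈ Finset.range Te,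
        (u ((epochLearner u outer inner F U Te).play l (t₀ + i)) (l (t₀ + i)) -
          U (recent (fun i => l (t₀ + i)) Te) (outer.act o))⟫) inner.start [] := by
  obtain ⟨k, rfl⟩ : ∃ k, Te = k + 1 := ⟨Te - 1, by omega⟩
  have ih := epochLearner_stateAt_add u outer inner F U (k + 1) l h₀ (Nat.lt_succ_self k)
  have hp : (epochLearner u outer inner F U (k + 1)).play l (t₀ + k) = inner.act (inner.stateAt
      (fun j => F (recent (fun i => l (t₀ + i)) (j + 1)) (outer.act o)) k) := by
    rw [OnlineAlgorithm.play, ih]; rfl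
  rw [← add_assoc]
  change (epochLearner u outer inner F U (k + 1)).update
    ((epochLearner u outer inner F U (k + 1)).stateAt l (t₀ + k)) (l (t₀ + k)) = _
  have hcons : (inner.act (inner.stateAt
      (fun j => F (recent (fun i => l (t₀ + i)) (j + 1)) (outer.act o)) k), l (t₀ + k)) ::
      recent (fun i => ((epochLearner u outer inner F U (k + 1)).play l (t₀ + i), l (t₀ + i))) k =
      recent (fun i => ((epochLearner u outer inner F U (k + 1)).play l (t₀ + i), l (t₀ + i)))
        (k + 1) := by
    rw [← hp]; rfl
  rw [ih]
  generalize hh : recent (fun i => ((epochLearner u outer inner F U (k + 1)).play l (t₀ + i),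
    l (t₀ + i))) k = hist at hcons ⊢
  simp only [epochLearner]
  rw [if_pos (by rw [hcons, length_recent])]
  rw [hcons, map_recent, map_recent, sum_recent]
  rfl

/-- The direction of epoch `e`. -/
noncomputable def epochDirection (e : ℕ) : Euc d :=
  outer.act (EpochState.outer ((epochLearner u outer inner F U Te).stateAt l (e * Te)))

/-- The target of epoch `e`. -/
noncomputable def epochTarget (e : ℕ) : Euc d :=
  U (recent (fun i => l (e * Te + i)) Te) (epochDirection u outer inner F U Te l e)

/-- The vector fed to the outer oracle after epoch `e`. -/
noncomputable def epochGain (e : ℕ) : Euc d :=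
  (1 / (Te : ℝ)) • ∑ i ∈ Finset.range Te,
    (u ((epochLearner u outer inner F U Te).play l (e * Te + i)) (l (e * Te + i)) -
      epochTarget u outer inner F U Te l e)

/-- The gains depend on the learner's own play, yet once the adversary's sequence is fixed they form
a fixed sequence. The outer oracle can thus be viewed as running alone against it, and its regret
bound applies. -/
lemma epochLearner_stateAt_mul (hTe : 0 < Te) (e : ℕ) :
    (epochLearner u outer inner F U Te).stateAt l (e * Te) =
      EpochState.mk (outer.stateAt (fun e x => -⟪x, epochGain u outer inner F U Te l e⟫) e)
        inner.start [] := by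
  induction e with
  | zero => rw [zero_mul]; rfl
  | succ e ih =>
    rw [Nat.succ_mul, epochLearner_stateAt_add_length u outer inner F U Te l hTe ih]
    simp only [OnlineAlgorithm.stateAt, epochGain, epochTarget, epochDirection, ih]
    rfl

lemma epochDirection_eq (hTe : 0 < Te) (e : ℕ) :
    epochDirection u outer inner F U Te l e =
      outer.play (fun e x => -⟪x, epochGain u outer inner F U Te l e⟫) e := by
  rw [epochDirection, epochLearner_stateAt_mul u outer inner F U Te l hTe e]
  rfl

lemma epochLearner_play (e : ℕ) {k : ℕ} (hk : k < Te) :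
    (epochLearner u outer inner F U Te).play l (e * Te + k) =
      inner.play (fun j => F (recent (fun i => l (e * Te + i)) (j + 1))
        (epochDirection u outer inner F U Te l e)) k := by
  have hTe : 0 < Te := by omega
  rw [OnlineAlgorithm.play, epochDirection_eq u outer inner F U Te l hTe, epochLearner_stateAt_add
    u outer inner F U Te l (epochLearner_stateAt_mul u outer inner F U Te l hTe e) hk]
  rfl

end EpochStates

/-! ### Regret within an epoch -/

section Epoch

variable {m n d : ℕ} {P : Set (Euc m)} {L : Set (Euc n)} {u : Euc m → Euc n → Euc d}
  {pstar : Euc n → Euc m}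

lemma expertOracle_play (N : Finset (Euc m)) (alg : OnlineAlgorithm (N → ℝ) (N → ℝ))
    (b : ℕ → Euc m → ℝ) (t : ℕ) :
    (expertOracle N alg).play b t =
      ∑ i : N, alg.play (fun s (i : N) => b s i) t i • (i : Euc m) := by
  have h : (expertOracle N alg).stateAt b t = alg.stateAt (fun s (i : N) => b s i) t := by
    induction t with
    | zero => rfl
    | succ t ih =>
      change alg.update ((expertOracle N alg).stateAt b t) _ = _
      rw [ih]
      rfl
  rw [OnlineAlgorithm.play, h]
  rfl

lemma expertOracle_msMwC_play_mem {N : Finset (Euc m)} (hP : Convex ℝ P)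
    (hN : (N : Set (Euc m)) ⊆ P) (hne : N.Nonempty) {k : ℕ} (hk : 0 < k)
    (b : ℕ → Euc m → ℝ) (t : ℕ) : (expertOracle N (msMwC N k)).play b t ∈ P := by
  have : Nonempty N := hne.to_subtype
  rw [expertOracle_play]
  have hw := msMwC_play_mem hk (fun s (i : N) => b s i) t
  exact hP.sum_mem (fun i _ => (pos_of_mem_truncatedSimplex hk hw i).le) hw.2
    fun i _ => hN i.2

lemma finite_image_mem {α : Type} (f : α → ℝ) (ls : List α) : (f '' {l | l ∈ ls}).Finite :=
  (List.finite_toSet ls).image f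

lemma le_runningMaxLoss (u : Euc m → Euc n → Euc d) {ls : List (Euc n)} (lam : Euc d) (p : Euc m)
    {l : Euc n} (hl : l ∈ ls) : ⟪lam, u p l⟫ ≤ runningMaxLoss u ls lam p :=
  le_csSup (finite_image_mem _ ls).bddAbove ⟨l, hl, rfl⟩

lemma runningMaxLoss_le {ls : List (Euc n)} (hne : ls ≠ []) {lam : Euc d} {p : Euc m} {c : ℝ}
    (h : ∀ l ∈ ls, ⟪lam, u p l⟫ ≤ c) : runningMaxLoss u ls lam p ≤ c := by
  obtain ⟨x, hx⟩ := List.exists_mem_of_ne_nil ls hne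
  refine csSup_le ⟨_, x, hx, rfl⟩ ?_
  rintro _ ⟨l, hl, rfl⟩
  exact h l hl

lemma IsInstance.convexOn_runningMaxLoss (h : IsInstance P L u pstar) {ls : List (Euc n)}
    (hne : ls ≠ []) (hls : ∀ l ∈ ls, l ∈ L) (lam : Euc d) :
    ConvexOn ℝ P (runningMaxLoss u ls lam) := by
  refine ⟨h.convex_P, fun p hp q hq a b ha hb hab => runningMaxLoss_le hne fun l hl => ?_⟩
  refine ((h.convexOn_left lam (hls l hl)).2 hp hq ha hb hab).trans ?_
  exact add_le_add (mul_le_mul_of_nonneg_left (le_runningMaxLoss u lam p hl) ha)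
    (mul_le_mul_of_nonneg_left (le_runningMaxLoss u lam q hl) hb)

lemma IsInstance.abs_runningMaxLoss_le (h : IsInstance P L u pstar) {ls : List (Euc n)}
    (hne : ls ≠ []) (hls : ∀ l ∈ ls, l ∈ L) {lam : Euc d} (hlam : ‖lam‖ ≤ 1) {p : Euc m}
    (hp : p ∈ P) : |runningMaxLoss u ls lam p| ≤ 1 := by
  obtain ⟨x, hx⟩ := List.exists_mem_of_ne_nil ls hne
  refine abs_le.2 ⟨?_, runningMaxLoss_le hne fun l hl =>
    (abs_le.1 (h.abs_inner_le hlam hp (hls l hl))).2⟩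
  exact (abs_le.1 (h.abs_inner_le hlam hp (hls x hx))).1.trans (le_runningMaxLoss u lam p hx)

/-- Regret of the inner oracle in an epoch, relative to the target of the epoch. -/
theorem IsInstance.epoch_regret (h : IsInstance P L u pstar) {T : ℕ} {N : Finset (Euc m)}
    (hN : IsFineCover P T N) {lam : Euc d} (hlam : ‖lam‖ ≤ 1)
    {sel : List (Euc n) → Euc d → Euc n} (hsel : IsMaximinSelector P u sel) {k : ℕ} (hk : 0 < k)
    (hkT : k ≤ T) {l : ℕ → Euc n} (hl : ∀ t, l t ∈ L) :
    ∑ t ∈ Finset.range k, ⟪lam, u ((expertOracle N (msMwC N k)).play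
        (fun j => runningMaxLoss u (recent l (j + 1)) lam) t) (l t)⟫ ≤
      k * ⟪lam, maximinTarget u pstar sel (recent l k) lam⟫ + (64 * Real.log N.card + 7) := by
  have hrne : ∀ j, recent l (j + 1) ≠ [] := fun j => by simp [recent]
  have hrL : ∀ j, ∀ x ∈ recent l j, x ∈ L := fun j x hx => by
    obtain ⟨i, -, rfl⟩ := (mem_recent l).1 hx
    exact hl i
  have hkne : recent l k ≠ [] := by
    obtain ⟨j, rfl⟩ : ∃ j, k = j + 1 := ⟨k - 1, by omega⟩
    exact hrne j
  obtain ⟨-, a, haP, ha⟩ := h.exists_le_maximinTarget hlam hkne (hrL k) hsel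
  obtain ⟨q, hqN, hq⟩ := hN.cover a haP
  have : Nonempty N := ⟨⟨q, hqN⟩⟩
  have hNP : ∀ i : N, (i : Euc m) ∈ P := fun i => hN.subset i.2
  set V := ⟪lam, maximinTarget u pstar sel (recent l k) lam⟫
  let b : ℕ → N → ℝ := fun t i => runningMaxLoss u (recent l (t + 1)) lam i
  have hb : ∀ t i, |b t i| ≤ 1 := fun t i =>
    h.abs_runningMaxLoss_le (hrne t) (hrL _) hlam (hNP i)
  -- A running maximum over a growing list can only grow; this is what makes the inner regret
  -- independent of the epoch length.
  have hmono : Monotone b := by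
    refine monotone_nat_of_le_succ fun t i => runningMaxLoss_le (hrne t) fun x hx => ?_
    exact le_runningMaxLoss u lam _ (List.mem_cons_of_mem _ hx)
  have hreg := msMwC_regret hk hb hmono ⟨q, hqN⟩ le_rfl
  -- The running max already includes the current action, so it dominates the true loss; Jensen then
  -- passes from the barycentre to the mixture of experts.
  have hround : ∀ t ∈ Finset.range k, ⟪lam, u ((expertOracle N (msMwC N k)).play
      (fun j => runningMaxLoss u (recent l (j + 1)) lam) t) (l t)⟫ ≤
      ∑ i, (msMwC N k).play b t i * b t i := by
    intro t _
    have hw := msMwC_play_mem hk b t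
    refine (le_runningMaxLoss u lam _ (by simp [recent] : l t ∈ recent l (t + 1))).trans ?_
    rw [expertOracle_play]
    exact (h.convexOn_runningMaxLoss (hrne t) (hrL _) lam).map_sum_le
      (fun i _ => (pos_of_mem_truncatedSimplex hk hw i).le) hw.2 fun i _ => hNP i
  have hT : (0 : ℝ) < T := by exact_mod_cast hk.trans_le hkT
  -- The minimax action a keeps all points of the epoch below V; replacing it by q costs 2/T by the
  -- Lipschitz bound, at most 2 per epoch. So 9/2 + 2 ≤ 7.
  have hqle : ∀ t ∈ Finset.range k, b t ⟨q, hqN⟩ ≤ V + 2 / T := by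
    intro t ht
    refine runningMaxLoss_le (hrne t) fun x hx => ?_
    have hxk : x ∈ recent l k := by
      obtain ⟨i, hi, rfl⟩ := (mem_recent l).1 hx
      exact (mem_recent l).2 ⟨i, by have := Finset.mem_range.1 ht; omega, rfl⟩
    have h1 := (abs_le.1 (h.inner_sub_le hlam (hrL _ x hx) haP (hN.subset hqN))).1
    have h2 := ha x hxk
    have h3 : 2 * dist a q ≤ 2 / T := by
      calc _ ≤ 2 * (1 / (T : ℝ)) := by gcongr
        _ = _ := by ring
    change ⟪lam, u q x⟫ ≤ _
    linarith
  have hsum := Finset.sum_le_sum hqle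
  rw [Finset.sum_const, Finset.card_range, nsmul_eq_mul, mul_add] at hsum
  have hk2 : (k : ℝ) * (2 / T) ≤ 2 := by
    rw [mul_div_assoc', div_le_iff₀ hT]
    have : (k : ℝ) ≤ T := by exact_mod_cast hkT
    linarith
  have hcard : (Fintype.card N : ℝ) = N.card := by simp
  rw [hcard] at hreg
  linarith [Finset.sum_le_sum hround]

end Epoch

/-! ### Tuning -/

section Tuning

variable {m T : ℕ}

lemma numEpochs_pos (hm : 0 < m) (hT : 0 < T) : 0 < numEpochs m T := by
  have : (0 : ℝ) < m := by exact_mod_cast hm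
  have : (0 : ℝ) < T := by exact_mod_cast hT
  exact Nat.ceil_pos.2 (by positivity)

lemma epochLength_pos (hm : 0 < m) (hT : 0 < T) : 0 < epochLength m T := by
  have : (0 : ℝ) < numEpochs m T := by exact_mod_cast numEpochs_pos hm hT
  have : (0 : ℝ) < T := by exact_mod_cast hT
  exact Nat.ceil_pos.2 (by positivity)

lemma epochLength_le (hm : 0 < m) (hT : 0 < T) : epochLength m T ≤ T := by
  have : (1 : ℝ) ≤ numEpochs m T := by exact_mod_cast numEpochs_pos hm hT
  exact Nat.ceil_le.2 (div_le_self (Nat.cast_nonneg T) this)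

lemma rpow_third_mul_rpow_neg_third (hm : 0 < m) (hT : 0 < T) :
    (m : ℝ) ^ (1 / 3 : ℝ) * (T : ℝ) ^ (-(1 / 3) : ℝ) = (((T : ℝ) / m) ^ (1 / 3 : ℝ))⁻¹ := by
  have hm' : (0 : ℝ) < m := by exact_mod_cast hm
  have hT' : (0 : ℝ) < T := by exact_mod_cast hT
  rw [Real.rpow_neg hT'.le, Real.div_rpow hT'.le hm'.le, inv_div, ← div_eq_mul_inv]

/-- The target rate is x⁻¹ up to the constant and the logarithm. Since x² ≥ 1 and T/K ≥ 1 for K =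
`numEpochs m T`, both ceilings at most double: x² ≤ K ≤ 2x² and T/K ≤ τ ≤ 2T/K. This uses m ≤ T. -/
lemma epochLength_bounds (hm : 0 < m) (hmT : m ≤ T) {x : ℝ}
    (hx : x = ((T : ℝ) / m) ^ (1 / 3 : ℝ)) :
    1 ≤ x ∧ m * x ≤ 2 * epochLength m T ∧ epochLength m T * x ^ 2 ≤ 2 * T := by
  have hm' : (1 : ℝ) ≤ m := by exact_mod_cast hm
  have hmT' : (m : ℝ) ≤ T := by exact_mod_cast hmT
  have hT' : (0 : ℝ) < T := by linarith
  have hTm : 1 ≤ (T : ℝ) / m := (one_le_div (by linarith)).2 hmT'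
  have hx1 : 1 ≤ x := hx ▸ Real.one_le_rpow hTm (by norm_num)
  have hx2 : ((T : ℝ) / m) ^ (2 / 3 : ℝ) = x ^ 2 := by
    rw [hx, ← Real.rpow_natCast, ← Real.rpow_mul (by linarith)]; norm_num
  have hx3 : x ^ 3 * m = T := by
    rw [hx, ← Real.rpow_natCast, ← Real.rpow_mul (by linarith)]
    norm_num
    field_simp
  have hK1 : x ^ 2 ≤ numEpochs m T := hx2 ▸ Nat.le_ceil _
  have hK2 : (numEpochs m T : ℝ) < x ^ 2 + 1 := hx2 ▸ Nat.ceil_lt_add_one (by positivity)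
  have hKT : (numEpochs m T : ℝ) ≤ T := by
    have : numEpochs m T ≤ T := by
      refine Nat.ceil_le.2 ?_
      rw [hx2]
      nlinarith [mul_nonneg (pow_nonneg (zero_le_one.trans hx1) 2) (sub_nonneg.2 hx1),
        mul_nonneg (pow_nonneg (zero_le_one.trans hx1) 3) (sub_nonneg.2 hm')]
    exact_mod_cast this
  set K : ℝ := (numEpochs m T : ℝ)
  have hxx : 1 ≤ x ^ 2 := one_le_pow₀ hx1
  have hKpos : 0 < K := by linarith
  have hL1 : (T : ℝ) / K ≤ epochLength m T := Nat.le_ceil _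
  have hL2 : (epochLength m T : ℝ) < T / K + 1 := Nat.ceil_lt_add_one (by positivity)
  rw [div_le_iff₀ hKpos] at hL1
  have h1 : 1 ≤ (T : ℝ) / K := (one_le_div hKpos).2 hKT
  refine ⟨hx1, ?_, ?_⟩
  · have hle : (epochLength m T : ℝ) * K ≤ epochLength m T * (2 * x ^ 2) :=
      mul_le_mul_of_nonneg_left (by linarith) (Nat.cast_nonneg _)
    have : m * x * x ^ 2 ≤ 2 * epochLength m T * x ^ 2 := by
      calc m * x * x ^ 2 = T := by rw [← hx3]; ring
        _ ≤ _ := by linarith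
    exact le_of_mul_le_mul_right this (by linarith)
  · calc (epochLength m T : ℝ) * x ^ 2 ≤ (2 * (T / K)) * K :=
        mul_le_mul (by linarith) hK1 (by positivity) (by positivity)
      _ = 2 * T := by field_simp

/-- For m ≤ T, log m is absorbed into a second log T. Then 64 log 3 ≤ 96, and the remaining 32m
covers the 7. -/
lemma log_card_le {c : ℕ} (hm : 0 < m) (hmT : m ≤ T) (hc : 0 < c)
    (hcard : c ≤ (3 * m * T) ^ m) :
    64 * Real.log c + 7 ≤ 128 * m * (1 + Real.log T) := by
  have hm' : (1 : ℝ) ≤ m := by exact_mod_cast hm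
  have hmT' : (m : ℝ) ≤ T := by exact_mod_cast hmT
  have hT' : (1 : ℝ) ≤ T := by linarith
  have h1 : Real.log c ≤ m * (Real.log 3 + 2 * Real.log T) := by
    have h2 : (c : ℝ) ≤ (3 * m * T : ℝ) ^ m := by exact_mod_cast hcard
    refine (Real.log_le_log (by exact_mod_cast hc) h2).trans ?_
    rw [Real.log_pow, Real.log_mul (by positivity) (by positivity),
      Real.log_mul (by positivity) (by positivity)]
    have := Real.log_le_log (by linarith) hmT'
    exact mul_le_mul_of_nonneg_left (by linarith) (by linarith)
  have h3 : Real.log 3 ≤ 3 / 2 := by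
    rw [Real.log_le_iff_le_exp (by norm_num)]
    have := Real.quadratic_le_exp_of_nonneg (show (0 : ℝ) ≤ 3 / 2 by norm_num)
    norm_num at this ⊢
    linarith
  nlinarith [Real.log_nonneg hT']

lemma tuned_bound {E c : ℕ} (hm : 0 < m) (hmT : m ≤ T) (hE : E * epochLength m T ≤ T)
    (hc : 0 < c) (hcard : c ≤ (3 * m * T) ^ m) :
    (epochLength m T * (6 * √E) + E * (64 * Real.log c + 7) + 2 * epochLength m T) / T ≤
      300 * (m : ℝ) ^ (1 / 3 : ℝ) * (T : ℝ) ^ (-(1 / 3) : ℝ) * (1 + Real.log T) := by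
  have hm' : (1 : ℝ) ≤ m := by exact_mod_cast hm
  have hT0 : 0 < T := by omega
  have hT' : (1 : ℝ) ≤ T := by exact_mod_cast hT0
  obtain ⟨x, hx⟩ : ∃ x : ℝ, x = ((T : ℝ) / m) ^ (1 / 3 : ℝ) := ⟨_, rfl⟩
  obtain ⟨hx1, h1, h2⟩ := epochLength_bounds hm hmT hx
  have hR := log_card_le hm hmT hc hcard
  have hlog := Real.log_nonneg hT'
  rw [mul_assoc 300, rpow_third_mul_rpow_neg_third hm hT0, ← hx]
  have hE' : (E : ℝ) * epochLength m T ≤ T := by exact_mod_cast hE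
  have hT0' : (0 : ℝ) ≤ epochLength m T := Nat.cast_nonneg _
  have hE0 : (0 : ℝ) ≤ E := Nat.cast_nonneg _
  set τ : ℝ := (epochLength m T : ℝ)
  set R : ℝ := 64 * Real.log c + 7
  set ℓ : ℝ := 1 + Real.log T
  have hx0 : 0 < x := by linarith
  rw [div_le_iff₀ (by linarith)]
  -- The square of the left side is (Eτ)(τx²) ≤ 2T².
  have a1 : τ * √E * x ≤ 3 / 2 * T := by
    refine le_of_sq_le_sq ?_ (by linarith)
    have : (τ * √E * x) ^ 2 = (E * τ) * (τ * x ^ 2) := by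
      rw [mul_pow, mul_pow, Real.sq_sqrt hE0]; ring
    rw [this]
    calc (E * τ) * (τ * x ^ 2) ≤ T * (2 * T) := by gcongr
      _ ≤ _ := by nlinarith
  have a2 : E * R * x ≤ 256 * T * ℓ := by
    calc E * R * x ≤ E * (128 * m * ℓ) * x := by gcongr
      _ = 128 * E * ℓ * (m * x) := by ring
      _ ≤ 128 * E * ℓ * (2 * τ) := by gcongr
      _ = 256 * ℓ * (E * τ) := by ring
      _ ≤ 256 * ℓ * T := by gcongr
      _ = _ := by ring
  have a3 : 2 * τ * x ≤ 4 * T := by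
    have : τ * x ≤ τ * x ^ 2 := by gcongr; nlinarith
    linarith
  -- The three terms contribute 9, 256 and 4, in all 269 ≤ 300.
  have key : (τ * (6 * √E) + E * R + 2 * τ) * x ≤ 300 * ℓ * T := by
    have : (T : ℝ) ≤ ℓ * T := le_mul_of_one_le_left (by linarith) (by simp only [ℓ]; linarith)
    nlinarith
  calc τ * (6 * √E) + E * R + 2 * τ ≤ 300 * ℓ * T / x := (le_div_iff₀ hx0).2 key
    _ = _ := by ring

end Tuning
/-! ### The guarantee of the tuned algorithm -/

section Main

lemma norm_le_of_forall_inner_le {d : ℕ} {x : Euc d} {c : ℝ} (hc : 0 ≤ c)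
    (h : ∀ z : Euc d, ‖z‖ ≤ 1 → ⟪z, x⟫ ≤ c) : ‖x‖ ≤ c := by
  rcases eq_or_ne x 0 with rfl | hx
  · simpa using hc
  have hx' : 0 < ‖x‖ := norm_pos_iff.2 hx
  have := h (‖x‖⁻¹ • x) (by rw [norm_smul, norm_inv, norm_norm, inv_mul_cancel₀ hx'.ne'])
  rwa [inner_smul_left, real_inner_self_eq_norm_sq, map_inv₀, conj_trivial, sq,
    inv_mul_cancel_left₀ hx'.ne'] at this

lemma sum_range_mul {M : Type*} [AddCommMonoid M] (f : ℕ → M) (a b : ℕ) :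
    ∑ t ∈ Finset.range (a * b), f t =
      ∑ e ∈ Finset.range a, ∑ i ∈ Finset.range b, f (e * b + i) := by
  induction a with
  | zero => simp
  | succ a ih => rw [Nat.succ_mul, Finset.sum_range_add, ih, Finset.sum_range_succ]

variable {m n d : ℕ} {P : Set (Euc m)} {L : Set (Euc n)} {u : Euc m → Euc n → Euc d}
  {pstar : Euc n → Euc m} {T : ℕ} {N : Finset (Euc m)} {lam₁ : Euc d}
  {sel : List (Euc n) → Euc d → Euc n} {l : ℕ → Euc n}

lemma IsFineCover.nonempty (hN : IsFineCover P T N) (hP : P.Nonempty) : N.Nonempty := by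
  obtain ⟨p, hp⟩ := hP
  obtain ⟨q, hq, -⟩ := hN.cover p hp
  exact ⟨q, hq⟩

lemma IsInstance.fastLearner_play_mem (h : IsInstance P L u pstar) (hm : 0 < m) (hT : 0 < T)
    (hN : IsFineCover P T N) (t : ℕ) : (fastLearner u pstar T N lam₁ sel).play l t ∈ P := by
  have hτ := epochLength_pos hm hT
  rw [← Nat.div_add_mod t (epochLength m T), mul_comm, fastLearner,
    epochLearner_play _ _ _ _ _ _ _ _ (Nat.mod_lt _ hτ)]
  exact expertOracle_msMwC_play_mem h.convex_P hN.subset (hN.nonempty ⟨0, h.zero_mem⟩) hτ _ _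

lemma IsInstance.response_norm_le (h : IsInstance P L u pstar) {x : Euc n} (hx : x ∈ L) :
    ‖u (pstar x) x‖ ≤ 1 := h.norm_le_one _ (h.response_mem x hx) x hx

lemma IsInstance.infDist_le_two (h : IsInstance P L u pstar)
    {alg : OnlineAlgorithm (Euc m) (Euc n)} (hT : 0 < T) (hl : ∀ t, l t ∈ L)
    (hplay : ∀ t, alg.play l t ∈ P) :
    Metric.infDist (avgPayoff u alg T l) (targetSet u pstar (convexHull ℝ (l '' {t | t < T}))) ≤
      2 := by
  have hT' : (0 : ℝ) < T := by exact_mod_cast hT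
  have h0 : u (pstar (l 0)) (l 0) ∈ targetSet u pstar (convexHull ℝ (l '' {t | t < T})) :=
    subset_convexHull ℝ _ ⟨l 0, subset_convexHull ℝ _ ⟨0, hT, rfl⟩, rfl⟩
  refine (Metric.infDist_le_dist_of_mem h0).trans ?_
  rw [dist_eq_norm]
  have h1 : ‖avgPayoff u alg T l‖ ≤ 1 := by
    rw [avgPayoff, norm_smul, Real.norm_of_nonneg (by positivity), one_div, inv_mul_le_iff₀ hT',
      mul_one]
    refine (norm_sum_le _ _).trans ?_
    calc _ ≤ ∑ _t ∈ Finset.range T, (1 : ℝ) :=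
          Finset.sum_le_sum fun t _ => h.norm_le_one _ (hplay t) _ (hl t)
      _ = T := by simp
  linarith [_root_.norm_sub_le (avgPayoff u alg T l) (u (pstar (l 0)) (l 0)),
    h.response_norm_le (hl 0)]

/-- The epoch-wise guarantee behind the rate, before tuning. -/
theorem IsInstance.infDist_fastLearner_le (h : IsInstance P L u pstar) (hm : 0 < m) (hT : 0 < T)
    (hN : IsFineCover P T N) (hlam : ‖lam₁‖ ≤ 1) (hsel : IsMaximinSelector P u sel)
    (hl : ∀ t, l t ∈ L) {E : ℕ} (hE : E = T / epochLength m T) :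
    Metric.infDist (avgPayoff u (fastLearner u pstar T N lam₁ sel) T l)
        (targetSet u pstar (convexHull ℝ (l '' {t | t < T}))) ≤
      (epochLength m T * (6 * √E) + E * (64 * Real.log N.card + 7) + 2 * epochLength m T) / T := by
  have hT' : (0 : ℝ) < T := by exact_mod_cast hT
  have hτ := epochLength_pos hm hT
  have hτT := epochLength_le hm hT
  have hplay : ∀ t, (fastLearner u pstar T N lam₁ sel).play l t ∈ P :=
    fun t => h.fastLearner_play_mem hm hT hN t
  have hdir := epochDirection_eq u (ogd lam₁) (expertOracle N (msMwC N (epochLength m T)))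
    (runningMaxLoss u) (maximinTarget u pstar sel) (epochLength m T) l hτ
  have hinner := epochLearner_play u (ogd lam₁) (expertOracle N (msMwC N (epochLength m T)))
    (runningMaxLoss u) (maximinTarget u pstar sel) (epochLength m T) l
  change ∀ e k, k < epochLength m T → (fastLearner u pstar T N lam₁ sel).play l _ = _ at hinner
  set τ := epochLength m T with hτdef
  have hτ' : (0 : ℝ) < τ := by exact_mod_cast hτ
  set R : ℝ := 64 * Real.log N.card + 7 with hRdef
  have hR0 : 0 ≤ R := by
    have : 0 ≤ Real.log N.card := Real.log_natCast_nonneg _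
    linarith
  set p := (fastLearner u pstar T N lam₁ sel).play l with hp
  set lam := epochDirection u (ogd lam₁) (expertOracle N (msMwC N τ)) (runningMaxLoss u)
    (maximinTarget u pstar sel) τ l with hlamdef
  set v := epochTarget u (ogd lam₁) (expertOracle N (msMwC N τ)) (runningMaxLoss u)
    (maximinTarget u pstar sel) τ l with hv
  set g := epochGain u (ogd lam₁) (expertOracle N (msMwC N τ)) (runningMaxLoss u)
    (maximinTarget u pstar sel) τ l with hg
  have hgain : ∀ e, (τ : ℝ) • g e =
      ∑ i ∈ Finset.range τ, (u (p (e * τ + i)) (l (e * τ + i)) - v e) := fun e => by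
    change (τ : ℝ) • ((1 / (τ : ℝ)) • ∑ i ∈ Finset.range τ,
      (u (p (e * τ + i)) (l (e * τ + i)) - v e)) = _
    rw [smul_smul, mul_one_div_cancel hτ'.ne', one_smul]
  have hlamle : ∀ e, ‖lam e‖ ≤ 1 := fun e => by rw [hdir]; exact norm_ogd_play_le hlam e
  have hrL : ∀ e, ∀ x ∈ recent (fun i => l (e * τ + i)) τ, x ∈ L := fun e x hx => by
    obtain ⟨i, -, rfl⟩ := (mem_recent _).1 hx
    exact hl _
  have hrne : ∀ e, recent (fun i => l (e * τ + i)) τ ≠ [] := fun e => by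
    rw [← List.length_pos_iff, length_recent]; exact hτ
  have hselmem : ∀ e, sel (recent (fun i => l (e * τ + i)) τ) (lam e) ∈
      convexHull ℝ {k | k ∈ recent (fun i => l (e * τ + i)) τ} := fun e =>
    (h.exists_le_maximinTarget (hlamle e) (hrne e) (hrL e) hsel).1
  have hvnorm : ∀ e, ‖v e‖ ≤ 1 := fun e =>
    h.response_norm_le (convexHull_min (hrL e) h.convex_L (hselmem e))
  have hpay : ∀ t, ‖u (p t) (l t)‖ ≤ 1 := fun t => h.norm_le_one _ (hplay t) _ (hl t)
  have hgle : ∀ e, ‖g e‖ ≤ 2 := fun e => by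
    have h1 : ‖(τ : ℝ) • g e‖ ≤ τ * 2 := by
      rw [hgain]
      refine (norm_sum_le _ _).trans ?_
      calc _ ≤ ∑ _i ∈ Finset.range τ, (2 : ℝ) := Finset.sum_le_sum fun i _ => by
            linarith [_root_.norm_sub_le (u (p (e * τ + i)) (l (e * τ + i))) (v e),
              hpay (e * τ + i), hvnorm e]
        _ = τ * 2 := by simp
    rw [norm_smul, Real.norm_of_nonneg hτ'.le] at h1
    exact le_of_mul_le_mul_left h1 hτ'
  have hepoch : ∀ e, τ * ⟪lam e, g e⟫ ≤ R := fun e => by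
    have h1 := h.epoch_regret hN (hlamle e) hsel hτ hτT (l := fun i => l (e * τ + i))
      fun i => hl _
    rw [← inner_smul_right, hgain, inner_sum]
    simp only [inner_sub_right, Finset.sum_sub_distrib, Finset.sum_const, Finset.card_range,
      nsmul_eq_mul]
    have h2 : ∑ i ∈ Finset.range τ, ⟪lam e, u (p (e * τ + i)) (l (e * τ + i))⟫ ≤
        τ * ⟪lam e, v e⟫ + R := by
      refine le_of_eq_of_le (Finset.sum_congr rfl fun i hi => ?_) h1
      rw [hinner e i (Finset.mem_range.1 hi)]
    linarith
  -- Duality turns the norm into a best fixed direction z; the outer regret compares z with the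
  -- directions λ_e, and each ⟪λ_e, g_e⟫ is at most R/τ.
  have hG : (τ : ℝ) * ‖∑ e ∈ Finset.range E, g e‖ ≤ τ * (6 * √E) + E * R := by
    have h1 : ‖∑ e ∈ Finset.range E, g e‖ ≤ 6 * √E + E * (R / τ) := by
      refine norm_le_of_forall_inner_le (by positivity) fun z hz => ?_
      have h2 := ogd_regret (b := fun e x => -⟪x, g e⟫) hlam (E := E) (fun e _ => rfl)
        (fun e _ => hgle e) hz
      have h3 : ∑ e ∈ Finset.range E, ⟪lam e, g e⟫ ≤ E * (R / τ) := by
        calc _ ≤ ∑ _e ∈ Finset.range E, R / τ := Finset.sum_le_sum fun e _ => by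
              rw [le_div_iff₀ hτ', mul_comm]; exact hepoch e
          _ = _ := by simp
      simp only [inner_sub_left, Finset.sum_sub_distrib] at h2
      rw [inner_sum]
      simp only [hdir] at h3
      linarith
    calc _ ≤ τ * (6 * √E + E * (R / τ)) := mul_le_mul_of_nonneg_left h1 hτ'.le
      _ = _ := by field_simp
  -- The comparison point of S(Q) is the average of these: the epoch's target in complete epochs,
  -- and the response payoff at ℓ_0 in the remaining r ≤ τ rounds, where each round costs at most 2.
  let s : ℕ → Euc d := fun t => if t < E * τ then v (t / τ) else u (pstar (l 0)) (l 0)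
  have hEτ : E * τ ≤ T := hE ▸ Nat.div_mul_le_self T τ
  have hs : ∀ t, s t ∈ targetSet u pstar (convexHull ℝ (l '' {t | t < T})) := by
    intro t
    by_cases ht : t < E * τ
    · simp only [s, if_pos ht]
      refine subset_convexHull ℝ _ ⟨_, convexHull_mono ?_ (hselmem (t / τ)), rfl⟩
      intro x hx
      obtain ⟨i, hi, rfl⟩ := (mem_recent _).1 hx
      refine ⟨t / τ * τ + i, ?_, rfl⟩
      have h1 : t / τ < E := (Nat.div_lt_iff_lt_mul hτ).2 ht
      have h2 : (t / τ + 1) * τ ≤ E * τ := Nat.mul_le_mul_right τ h1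
      change t / τ * τ + i < T
      rw [Nat.succ_mul] at h2
      omega
    · simp only [s, if_neg ht]
      exact subset_convexHull ℝ _ ⟨l 0, subset_convexHull ℝ _ ⟨0, hT, rfl⟩, rfl⟩
  have hsnorm : ∀ t, ‖s t‖ ≤ 1 := fun t => by
    simp only [s]
    split_ifs
    exacts [hvnorm _, h.response_norm_le (hl 0)]
  have hc : (1 / (T : ℝ)) • ∑ t ∈ Finset.range T, s t ∈
      targetSet u pstar (convexHull ℝ (l '' {t | t < T})) := by
    rw [Finset.smul_sum]
    refine (convex_convexHull ℝ _).sum_mem (fun _ _ => by positivity) ?_ fun t _ => hs t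
    simp [hT'.ne']
  refine (Metric.infDist_le_dist_of_mem hc).trans ?_
  rw [dist_eq_norm, avgPayoff, ← smul_sub, ← Finset.sum_sub_distrib, norm_smul,
    Real.norm_of_nonneg (by positivity), one_div, inv_mul_eq_div]
  refine div_le_div_of_nonneg_right ?_ hT'.le
  obtain ⟨r, hr⟩ := Nat.exists_eq_add_of_le hEτ
  have hrτ : r ≤ τ := by
    have := Nat.mod_lt T hτ
    have := Nat.div_add_mod T τ
    rw [← hE, mul_comm] at this
    omega
  have hsplit : ∑ t ∈ Finset.range T, (u (p t) (l t) - s t) =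
      (τ : ℝ) • ∑ e ∈ Finset.range E, g e +
        ∑ i ∈ Finset.range r, (u (p (E * τ + i)) (l (E * τ + i)) - s (E * τ + i)) := by
    conv_lhs => rw [hr]
    rw [Finset.sum_range_add, sum_range_mul, Finset.smul_sum]
    congr 1
    refine Finset.sum_congr rfl fun e he => ?_
    rw [hgain]
    refine Finset.sum_congr rfl fun i hi => ?_
    have hi' := Finset.mem_range.1 hi
    have h2 : (e + 1) * τ ≤ E * τ := Nat.mul_le_mul_right τ (Finset.mem_range.1 he)
    rw [Nat.succ_mul] at h2
    have h3 : (e * τ + i) / τ = e := by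
      rw [mul_comm, Nat.mul_add_div hτ, Nat.div_eq_of_lt hi', add_zero]
    simp only [s, if_pos (show e * τ + i < E * τ by omega), h3]
  rw [hsplit]
  have hrest : ‖∑ i ∈ Finset.range r, (u (p (E * τ + i)) (l (E * τ + i)) - s (E * τ + i))‖ ≤
      2 * τ := by
    refine (norm_sum_le _ _).trans ?_
    calc _ ≤ ∑ _i ∈ Finset.range r, (2 : ℝ) := Finset.sum_le_sum fun i _ => by
          linarith [_root_.norm_sub_le (u (p (E * τ + i)) (l (E * τ + i))) (s (E * τ + i)),
            hpay (E * τ + i), hsnorm (E * τ + i)]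
      _ = r * 2 := by simp
      _ ≤ 2 * τ := by
        have : (r : ℝ) ≤ τ := by exact_mod_cast hrτ
        linarith
  have hfull : ‖(τ : ℝ) • ∑ e ∈ Finset.range E, g e‖ ≤ τ * (6 * √E) + E * R := by
    rwa [norm_smul, Real.norm_of_nonneg hτ'.le]
  exact (norm_add_le _ _).trans (add_le_add hfull hrest)

theorem IsInstance.fastLearner_infDist_le_rate (h : IsInstance P L u pstar) (hm : 0 < m)
    (hT : 0 < T) (hN : IsFineCover P T N) (hlam : ‖lam₁‖ ≤ 1) (hsel : IsMaximinSelector P u sel)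
    (hl : ∀ t, l t ∈ L) :
    Metric.infDist (avgPayoff u (fastLearner u pstar T N lam₁ sel) T l)
        (targetSet u pstar (convexHull ℝ (l '' {t | t < T}))) ≤
      300 * (m : ℝ) ^ (1 / 3 : ℝ) * (T : ℝ) ^ (-(1 / 3) : ℝ) * (1 + Real.log T) := by
  rcases le_or_gt m T with hmT | hmT
  · exact (h.infDist_fastLearner_le hm hT hN hlam hsel hl rfl).trans
      (tuned_bound hm hmT (Nat.div_mul_le_self T _)
        (Finset.card_pos.2 (hN.nonempty ⟨0, h.zero_mem⟩)) hN.card_le)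
  -- For m > T the factor m^(1/3) T^(-1/3) is at least 1, so the claimed rate exceeds the trivial
  -- bound 2.
  · refine (h.infDist_le_two hT hl fun t => h.fastLearner_play_mem hm hT hN t).trans ?_
    have hT' : (1 : ℝ) ≤ T := by exact_mod_cast hT
    have hmT' : (T : ℝ) ≤ m := by exact_mod_cast hmT.le
    have hle : (T : ℝ) / m ≤ 1 := div_le_one_of_le₀ hmT' (Nat.cast_nonneg m)
    have hpos : 0 < (T : ℝ) / m := div_pos (by linarith) (by linarith)
    have h1 : 1 ≤ (((T : ℝ) / m) ^ (1 / 3 : ℝ))⁻¹ :=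
      one_le_inv_iff₀.2 ⟨Real.rpow_pos_of_pos hpos _,
        Real.rpow_le_one hpos.le hle (by norm_num)⟩
    rw [mul_assoc 300, rpow_third_mul_rpow_neg_third hm hT]
    nlinarith [Real.log_nonneg hT']

theorem IsInstance.isStrictlyOpportunistic_fastLearner (h : IsInstance P L u pstar) (hm : 0 < m)
    (hT : 0 < T) (hN : IsFineCover P T N) (hlam : ‖lam₁‖ ≤ 1)
    (hsel : IsMaximinSelector P u sel) :
    IsStrictlyOpportunistic P L u pstar T (fastLearner u pstar T N lam₁ sel)
      (300 * (m : ℝ) ^ (1 / 3 : ℝ) * (T : ℝ) ^ (-(1 / 3) : ℝ) * (1 + Real.log T)) := by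
  intro l hl
  refine ⟨fun t _ => h.fastLearner_play_mem hm hT hN t, ?_⟩
  -- The sequence is constrained only before T, while the estimates above assume all its values in
  -- L. Changing it after the horizon affects neither the plays before T nor Q.
  let l' : ℕ → Euc n := fun t => if t < T then l t else l 0
  have hl' : ∀ t, l' t ∈ L := fun t => by
    simp only [l']
    split_ifs with ht
    exacts [hl t ht, hl 0 hT]
  have heq : ∀ t < T, l t = l' t := fun t ht => (if_pos ht).symm
  have havg : avgPayoff u (fastLearner u pstar T N lam₁ sel) T l =
      avgPayoff u (fastLearner u pstar T N lam₁ sel) T l' := by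
    simp only [avgPayoff]
    congr 1
    refine Finset.sum_congr rfl fun t ht => ?_
    have ht' := Finset.mem_range.1 ht
    rw [OnlineAlgorithm.play_congr _ fun s hs => heq s (hs.trans ht'), heq t ht']
  have himg : l '' {t | t < T} = l' '' {t | t < T} := Set.image_congr heq
  rw [havg, himg]
  exact h.fastLearner_infDist_le_rate hm hT hN hlam hsel hl'

end Main

end OppApproach

theorem mainTheorem1 :
    ∃ C : ℝ, 0 < C ∧
      ∀ (dP dL d : ℕ), 0 < dP →
      ∀ (P : Set (Euc dP)) (L : Set (Euc dL)) (u : Euc dP → Euc dL → Euc d)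
        (pstar : Euc dL → Euc dP), OppApproach.IsInstance P L u pstar →
      ∀ T : ℕ, 1 ≤ T →
        (∃ N : Finset (Euc dP), OppApproach.IsFineCover P T N) ∧
        ∀ N : Finset (Euc dP), OppApproach.IsFineCover P T N →
        ∀ lam₁ : Euc d, ‖lam₁‖ ≤ 1 →
        ∀ sel : List (Euc dL) → Euc d → Euc dL, OppApproach.IsMaximinSelector P u sel →
          OppApproach.IsStrictlyOpportunistic P L u pstar T
            (OppApproach.fastLearner u pstar T N lam₁ sel)
            (C * (dP : ℝ) ^ (1 / 3 : ℝ) * (T : ℝ) ^ (-(1 / 3) : ℝ) * (1 + Real.log T)) :=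
  ⟨300, by norm_num, fun _ _ _ hm _ _ _ _ h _ hT =>
    ⟨OppApproach.exists_isFineCover hm hT h.subset_ball, fun _ hN _ hlam _ hsel =>
      h.isStrictlyOpportunistic_fastLearner hm hT hN hlam hsel⟩⟩
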